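/- Let $\mathsf k$ be a field and let $A$ be a unital, counital DG-bialgebra over $\mathsf k$ (a $\mathbb Z$-graded complex with differential of degree $1$, with a DG-algebra structure and a coassociative, counital DG-coalgebra structure whose comultiplication $\Delta$ and counit are morphisms of DG-algebras, $A\otimes A$ carrying the multiplication with Koszul signs). **Cobar constructions.** Let $\operatorname{Cobar}(A)=\prod_{n\ge 0}A[-1]^{\otimes n}$ (product of graded vector spaces) be the completed tensor algebra of $A[-1]$, made a DG-algebra by the differential which on generators is $d_A+\Delta$ (with the Koszul signs of $A[-1]$, i.e. $s x\mapsto -s(dx)+\sum(-1)^{|x'|+1}sx'\otimes sx''$) and which is extended by the Leibniz rule. Let $\operatorname{Cobar}_{\operatorname{coaug}}(A)$ be the same graded algebra with the differential which on generators is $d_A+\Delta+1\otimes\operatorname{id}-\operatorname{id}\otimes 1$ (the last two terms being the graded commutator with the degree $1$ element $s1$). **The homotopy limit DG-category.** Let $\mathfrak A$ be the following DG-category, which is the explicit model (derived totalization) of the homotopy limit, in DG-categories, of the cosimplicial system of DG-algebras $\mathsf k\rightrightarrows A\to A^{\otimes 2}\cdots$, regarded as DG-categories with one object. Its objects are the sequences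 $a=(a_n)_{n\ge1}$ with $a_n\in(A^{\otimes n})^{1-n}$ that, as elements of degree $1$ of $\operatorname{Cobar}(A)$, satisfy the Maurer–Cartan equation $da+a^2=0$, and for which $a_1$ is homotopy invertible, i.e. the class of the closed element $a_1\in A^0$ is invertible in $H^0(A)$. The complex $\mathfrak A(a,b)$ is the graded vector space $\operatorname{Cobar}(A)$ with the differential $f\mapsto df+af-(-1)^{|f|}fb$, and the composition $\mathfrak A(a,b)\otimes\mathfrak A(b,c)\to\mathfrak A(a,c)$ is the multiplication of $\operatorname{Cobar}(A)$. **Coderived categories.** For a small DG-category $\mathcal C$ over $\mathsf k$, let $\mathsf{Ho}(\mathcal C)$ be the homotopy category of left DG-modules over $\mathcal C$ (complexes $M(a)$ with an associative unital action $\mathcal C(a,b)\otimes M(b)\to M(a)$; morphisms are closed morphisms of degree $0$ modulo homotopy). Let $\mathsf{CoAcycl}\subset\mathsf{Ho}(\mathcal C)$ be the smallest full triangulated subcategory that contains the totalizations of exact triples of DG-modules and is closed under infinite direct sums, and let $\mathsf D^{co}(\mathcal C)=\mathsf{Ho}(\mathcal C)/\mathsf{CoAcycl}$ be the Verdier quotient.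 A DG-algebra is regarded as a DG-category with one object. **Theorem.** There is an equivalence of (triangulated) coderived categories $$\mathsf D^{co}(\mathfrak A)\;\simeq\;\mathsf D^{co}(\operatorname{Cobar}_{\operatorname{coaug}}(A)),$$ and the same holds for right DG-modules, that is, $\mathsf D^{co}(\mathfrak A^{op})\simeq\mathsf D^{co}(\operatorname{Cobar}_{\operatorname{coaug}}(A)^{op})$. -/

import Mathlib

open CategoryTheory
open scoped TensorProduct

universe u

noncomputable section

namespace HomotopyCharacters

/-! ## Signs -/

/-- The sign `(-1) ^ n`, as a scalar. -/
def sgn (k : Type u) [Field k] (n : ℤ) : k := ((n.negOnePow : ℤˣ) : ℤ)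

section Signs

variable (k : Type u) [Field k]

@[simp] theorem sgn_zero : sgn k 0 = 1 := by simp [sgn]

@[simp] theorem sgn_one : sgn k 1 = -1 := by simp [sgn]

theorem sgn_add (m n : ℤ) : sgn k (m + n) = sgn k m * sgn k n := by
  simp [sgn, Int.negOnePow_add]

@[simp] theorem sgn_succ (n : ℤ) : sgn k (n + 1) = -sgn k n := by
  simp [sgn_add]

@[simp] theorem sgn_mul_self (n : ℤ) : sgn k n * sgn k n = 1 := by
  rw [← sgn_add, sgn, Int.negOnePow_even _ ⟨n, rfl⟩]; simp

@[simp] theorem sgn_smul_sgn_smul {M : Type*} [AddCommGroup M] [Module k M] (n : ℤ) (x : M) :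
    sgn k n • sgn k n • x = x := by
  rw [smul_smul, sgn_mul_self, one_smul]

end Signs

/-! ## DG-categories and DG-algebras -/

/-- A small DG-category over `k`: a category enriched in complexes of `k`-vector spaces
(cohomological grading).  Composition is written in diagrammatic order:
`comp : Hom a b ⊗ Hom b c → Hom a c`. -/
structure DGCategory (k : Type u) [Field k] where
  Obj : Type u
  Hom : Obj → Obj → ℤ → Type u
  [addCommGroup : ∀ a b i, AddCommGroup (Hom a b i)]
  [module : ∀ a b i, Module k (Hom a b i)]
  d : ∀ {a b : Obj} {i j : ℤ}, i + 1 = j → (Hom a b i →ₗ[k] Hom a b j)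
  one : ∀ a : Obj, Hom a a 0
  comp : ∀ {a b c : Obj} {i j n : ℤ}, i + j = n → (Hom a b i →ₗ[k] Hom b c j →ₗ[k] Hom a c n)
  d_d : ∀ {a b : Obj} {i j l : ℤ} (h : i + 1 = j) (h' : j + 1 = l) (f : Hom a b i),
    d h' (d h f) = 0
  d_comp : ∀ {a b c : Obj} {i j n i' j' n' : ℤ} (h : i + j = n) (hi : i + 1 = i')
    (hj : j + 1 = j') (hn : n + 1 = n') (h₁ : i' + j = n') (h₂ : i + j' = n')
    (f : Hom a b i) (g : Hom b c j),
    d hn (comp h f g) = comp h₁ (d hi f) g + sgn k i • comp h₂ f (d hj g)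
  one_comp : ∀ {a b : Obj} {i : ℤ} (h : 0 + i = i) (f : Hom a b i), comp h (one a) f = f
  comp_one : ∀ {a b : Obj} {i : ℤ} (h : i + 0 = i) (f : Hom a b i), comp h f (one b) = f
  assoc : ∀ {a b c e : Obj} {i j l ij jl n : ℤ} (h₁ : i + j = ij) (h₂ : ij + l = n)
    (h₃ : j + l = jl) (h₄ : i + jl = n) (f : Hom a b i) (g : Hom b c j) (p : Hom c e l),
    comp h₂ (comp h₁ f g) p = comp h₄ f (comp h₃ g p)

attribute [instance] DGCategory.addCommGroup DGCategory.module

/-- A (unital, associative) DG-algebra over `k`, with cohomological grading. -/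
structure DGAlgebra (k : Type u) [Field k] where
  X : ℤ → Type u
  [addCommGroup : ∀ i, AddCommGroup (X i)]
  [module : ∀ i, Module k (X i)]
  d : ∀ {i j : ℤ}, i + 1 = j → (X i →ₗ[k] X j)
  one : X 0
  mul : ∀ {i j n : ℤ}, i + j = n → (X i →ₗ[k] X j →ₗ[k] X n)
  d_d : ∀ {i j l : ℤ} (h : i + 1 = j) (h' : j + 1 = l) (f : X i), d h' (d h f) = 0
  d_mul : ∀ {i j n i' j' n' : ℤ} (h : i + j = n) (hi : i + 1 = i')
    (hj : j + 1 = j') (hn : n + 1 = n') (h₁ : i' + j = n') (h₂ : i + j' = n')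
    (f : X i) (g : X j),
    d hn (mul h f g) = mul h₁ (d hi f) g + sgn k i • mul h₂ f (d hj g)
  one_mul : ∀ {i : ℤ} (h : 0 + i = i) (f : X i), mul h one f = f
  mul_one : ∀ {i : ℤ} (h : i + 0 = i) (f : X i), mul h f one = f
  assoc : ∀ {i j l ij jl n : ℤ} (h₁ : i + j = ij) (h₂ : ij + l = n)
    (h₃ : j + l = jl) (h₄ : i + jl = n) (f : X i) (g : X j) (p : X l),
    mul h₂ (mul h₁ f g) p = mul h₄ f (mul h₃ g p)

attribute [instance] DGAlgebra.addCommGroup DGAlgebra.module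

section Constructions

variable {k : Type u} [Field k]

/-- A DG-algebra, viewed as a DG-category with one object. -/
def DGAlgebra.toDGCategory (B : DGAlgebra k) : DGCategory k where
  Obj := PUnit
  Hom _ _ i := B.X i
  d h := B.d h
  one _ := B.one
  comp h := B.mul h
  d_d h h' f := B.d_d h h' f
  d_comp h hi hj hn h₁ h₂ f g := B.d_mul h hi hj hn h₁ h₂ f g
  one_comp h f := B.one_mul h f
  comp_one h f := B.mul_one h f
  assoc h₁ h₂ h₃ h₄ f g p := B.assoc h₁ h₂ h₃ h₄ f g p

/-- The full DG-subcategory on the objects that satisfy `P`. -/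
def DGCategory.full (C : DGCategory k) (P : C.Obj → Prop) : DGCategory k where
  Obj := {a : C.Obj // P a}
  Hom a b i := C.Hom a.1 b.1 i
  d h := C.d h
  one a := C.one a.1
  comp h := C.comp h
  d_d h h' f := C.d_d h h' f
  d_comp h hi hj hn h₁ h₂ f g := C.d_comp h hi hj hn h₁ h₂ f g
  one_comp h f := C.one_comp h f
  comp_one h f := C.comp_one h f
  assoc h₁ h₂ h₃ h₄ f g p := C.assoc h₁ h₂ h₃ h₄ f g p

/-- The opposite DG-category: `Hom^op a b = Hom b a`, with the composition
`f ⊗ g ↦ (-1) ^ (|f| |g|) g f`. -/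
def DGCategory.op (C : DGCategory k) : DGCategory k where
  Obj := C.Obj
  Hom a b i := C.Hom b a i
  d h := C.d h
  one a := C.one a
  comp {_ _ _ i j _} h := sgn k (i * j) • (C.comp ((add_comm j i).trans h)).flip
  d_d h h' f := C.d_d h h' f
  d_comp {a b c i j n i' j' n'} h hi hj hn h₁ h₂ f g := by
    subst hi hj
    simp only [LinearMap.smul_apply, LinearMap.flip_apply, map_smul]
    rw [C.d_comp _ rfl rfl hn ((by omega : j + 1 + i = n')) (by omega : j + (i + 1) = n')]
    rw [show (i + 1) * j = i * j + j by ring, show i * (j + 1) = i * j + i by ring,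
      sgn_add, sgn_add]
    simp only [smul_add, smul_smul]
    rw [mul_left_comm (sgn k i), sgn_mul_self, mul_one, add_comm]
  one_comp h f := by simp [C.comp_one]
  comp_one h f := by simp [C.one_comp]
  assoc {a b c e i j l ij jl n} h₁ h₂ h₃ h₄ f g p := by
    subst h₁ h₃
    simp only [LinearMap.smul_apply, LinearMap.flip_apply, map_smul, smul_smul, ← sgn_add]
    rw [C.assoc (add_comm l j) (by omega) (add_comm j i) (by omega)]
    congr 2
    ring

/-! ## Maurer-Cartan elements -/

/-- A Maurer-Cartan element: `x` of degree `1` with `d x + x ^ 2 = 0`. -/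
def DGAlgebra.IsMaurerCartan (B : DGAlgebra k) (x : B.X 1) : Prop :=
  B.d (show (1 : ℤ) + 1 = 2 by norm_num) x + B.mul (show (1 : ℤ) + 1 = 2 by norm_num) x x = 0

/-- The twisted differential `f ↦ d f + a f - (-1) ^ |f| f b`. -/
def DGAlgebra.twistD (B : DGAlgebra k) (a b : B.X 1) {i j : ℤ} (h : i + 1 = j) :
    B.X i →ₗ[k] B.X j :=
  B.d h + B.mul ((add_comm 1 i).trans h) a - sgn k i • (B.mul h).flip b

/-- The Maurer-Cartan DG-category of `B`: objects are the Maurer-Cartan elements, the complex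
of morphisms from `a` to `b` is `B` with the twisted differential `d f + a f - (-1) ^ |f| f b`,
and the composition `Hom a b ⊗ Hom b c → Hom a c` is the multiplication of `B`. -/
def DGAlgebra.MC (B : DGAlgebra k) : DGCategory k where
  Obj := {x : B.X 1 // B.IsMaurerCartan x}
  Hom _ _ i := B.X i
  d {a b _ _} h := B.twistD a.1 b.1 h
  one _ := B.one
  comp h := B.mul h
  d_d {a b i j l} h h' f := by
    subst h
    have ha := a.2
    have hb := b.2
    unfold DGAlgebra.IsMaurerCartan at ha hb
    rw [add_eq_zero_iff_eq_neg] at ha hb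
    simp only [DGAlgebra.twistD, LinearMap.sub_apply, LinearMap.add_apply, LinearMap.smul_apply,
      LinearMap.flip_apply, map_add, map_sub, map_smul, sgn_succ]
    rw [B.d_d, B.d_mul _ (show (1 : ℤ) + 1 = 2 by norm_num) rfl h' (by omega) (by omega),
      B.d_mul _ rfl (show (1 : ℤ) + 1 = 2 by norm_num) h' (by omega) (by omega), ha, hb,
      ← B.assoc (show (1 : ℤ) + 1 = 2 by norm_num) (by omega : 2 + i = l),
      B.assoc (rfl : i + 1 = i + 1) _ (show (1 : ℤ) + 1 = 2 by norm_num) (by omega : i + 2 = l),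
      B.assoc (by omega : 1 + i = i + 1) (by omega : i + 1 + 1 = l) rfl (by omega)]
    simp only [map_neg, LinearMap.neg_apply, sgn_one, smul_add, smul_sub, smul_neg, neg_smul,
      one_smul, sgn_smul_sgn_smul]
    abel
  d_comp {a b c i j n i' j' n'} h hi hj hn h₁ h₂ f g := by
    subst hi hj
    simp only [DGAlgebra.twistD, LinearMap.sub_apply, LinearMap.add_apply, LinearMap.smul_apply,
      LinearMap.flip_apply, map_add, map_sub, map_smul]
    rw [B.d_mul h rfl rfl hn h₁ h₂, ← B.assoc (by omega : 1 + i = i + 1) h₁,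
      B.assoc h hn rfl h₂, B.assoc rfl h₁ (by omega : 1 + j = j + 1) h₂, ← h, sgn_add]
    simp only [smul_add, smul_sub, smul_smul]
    abel
  one_comp h f := B.one_mul h f
  comp_one h f := B.mul_one h f
  assoc h₁ h₂ h₃ h₄ f g p := B.assoc h₁ h₂ h₃ h₄ f g p

end Constructions

/-! ## DG-modules -/

section Modules

variable {k : Type u} [Field k]

/-- A (left) DG-module over a DG-category `C`: complexes `X a` with an action
`Hom a b ⊗ X b → X a`.  Over a one-object DG-category this is a left DG-module over the
DG-algebra of endomorphisms; right DG-modules over `C` are left DG-modules over `C.op`. -/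
structure DGModule (C : DGCategory k) where
  X : C.Obj → ℤ → Type u
  [addCommGroup : ∀ a i, AddCommGroup (X a i)]
  [module : ∀ a i, Module k (X a i)]
  d : ∀ (a : C.Obj) {i j : ℤ}, i + 1 = j → (X a i →ₗ[k] X a j)
  act : ∀ {a b : C.Obj} {i j n : ℤ}, i + j = n → (C.Hom a b i →ₗ[k] X b j →ₗ[k] X a n)
  d_d : ∀ {a : C.Obj} {i j l : ℤ} (h : i + 1 = j) (h' : j + 1 = l) (x : X a i),
    d a h' (d a h x) = 0
  d_act : ∀ {a b : C.Obj} {i j n i' j' n' : ℤ} (h : i + j = n) (hi : i + 1 = i')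
    (hj : j + 1 = j') (hn : n + 1 = n') (h₁ : i' + j = n') (h₂ : i + j' = n')
    (f : C.Hom a b i) (x : X b j),
    d a hn (act h f x) = act h₁ (C.d hi f) x + sgn k i • act h₂ f (d b hj x)
  one_act : ∀ {a : C.Obj} {i : ℤ} (h : 0 + i = i) (x : X a i), act h (C.one a) x = x
  comp_act : ∀ {a b c : C.Obj} {i j l ij jl n : ℤ} (h₁ : i + j = ij) (h₂ : ij + l = n)
    (h₃ : j + l = jl) (h₄ : i + jl = n) (f : C.Hom a b i) (g : C.Hom b c j) (x : X c l),
    act h₂ (C.comp h₁ f g) x = act h₄ f (act h₃ g x)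

attribute [instance] DGModule.addCommGroup DGModule.module

namespace DGModule

variable {C : DGCategory k}

/-- Closed morphisms of degree `0` of DG-modules. -/
@[ext]
structure Hom (M N : DGModule C) where
  app : ∀ (a : C.Obj) (i : ℤ), M.X a i →ₗ[k] N.X a i
  app_d : ∀ {a : C.Obj} {i j : ℤ} (h : i + 1 = j) (x : M.X a i),
    app a j (M.d a h x) = N.d a h (app a i x)
  app_act : ∀ {a b : C.Obj} {i j n : ℤ} (h : i + j = n) (f : C.Hom a b i) (x : M.X b j),
    app a n (M.act h f x) = N.act h f (app b j x)

instance : Category (DGModule C) where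
  Hom M N := Hom M N
  id M := ⟨fun _ _ => LinearMap.id, fun _ _ => rfl, fun _ _ _ => rfl⟩
  comp f g := ⟨fun a i => (g.app a i).comp (f.app a i),
    fun h x => by simp [f.app_d, g.app_d], fun h y x => by simp [f.app_act, g.app_act]⟩

@[simp] theorem id_app (M : DGModule C) (a : C.Obj) (i : ℤ) (x : M.X a i) :
    Hom.app (𝟙 M) a i x = x := rfl

@[simp] theorem comp_app {M N P : DGModule C} (f : M ⟶ N) (g : N ⟶ P) (a : C.Obj) (i : ℤ)
    (x : M.X a i) : Hom.app (f ≫ g) a i x = g.app a i (f.app a i x) := rfl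

theorem hom_ext {M N : DGModule C} {f g : M ⟶ N}
    (h : ∀ (a : C.Obj) (i : ℤ) (x : M.X a i), f.app a i x = g.app a i x) : f = g :=
  Hom.ext (funext fun a => funext fun i => LinearMap.ext (h a i))

/-- A homotopy between two closed morphisms: a morphism of graded modules of degree `-1`
(so that `h (x m) = (-1) ^ |x| x (h m)`) with `f - g = d h + h d`. -/
structure Homotopy {M N : DGModule C} (f g : M ⟶ N) where
  h : ∀ (a : C.Obj) {i j : ℤ}, j + 1 = i → (M.X a i →ₗ[k] N.X a j)
  h_act : ∀ {a b : C.Obj} {i j n j' n' : ℤ} (e : i + j = n) (ej : j' + 1 = j) (en : n' + 1 = n)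
    (e' : i + j' = n') (y : C.Hom a b i) (x : M.X b j),
    h a en (M.act e y x) = sgn k i • N.act e' y (h b ej x)
  comm : ∀ {a : C.Obj} {i j l : ℤ} (e : i + 1 = j) (e' : l + 1 = i) (x : M.X a i),
    f.app a i x - g.app a i x = N.d a e' (h a e' x) + h a e (M.d a e x)

/-- The relation of being homotopic on closed morphisms of degree `0`. -/
def homotopic (C : DGCategory k) : HomRel (DGModule C) := fun _ _ f g => Nonempty (Homotopy f g)

/-- The shift `M[1]`. -/
abbrev shift (M : DGModule C) : DGModule C where
  X a i := M.X a (i + 1)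
  d a _ _ h := -M.d a (congrArg (· + 1) h)
  act {_ _ i j n} h := sgn k i • M.act ((add_assoc i j 1).symm.trans (congrArg (· + 1) h))
  d_d h h' x := by simp [M.d_d]
  d_act {a b i j n i' j' n'} h hi hj hn h₁ h₂ f x := by
    subst hi hj
    simp only [LinearMap.neg_apply, LinearMap.smul_apply, map_smul, map_neg, smul_neg, sgn_succ,
      neg_smul]
    rw [M.d_act _ rfl rfl _ (by omega : i + 1 + (j + 1) = n' + 1) (by omega)]
    simp only [smul_add, neg_add]
  one_act h x := by simp [M.one_act]
  comp_act {a b c i j l ij jl n} h₁ h₂ h₃ h₄ f g x := by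
    subst h₁ h₃
    simp only [LinearMap.smul_apply, map_smul, smul_smul, sgn_add]
    rw [M.comp_act rfl _ (by omega : j + (l + 1) = j + l + 1) (by omega), mul_comm]

theorem shift_d (M : DGModule C) (a : C.Obj) {i j : ℤ} (h : i + 1 = j) (x : M.X a (i + 1)) :
    M.shift.d a h x = -M.d a (congrArg (· + 1) h) x := rfl

theorem shift_act (M : DGModule C) {a b : C.Obj} {i j n : ℤ} (h : i + j = n)
    (y : C.Hom a b i) (x : M.X b (j + 1)) :
    M.shift.act h y x =
      sgn k i • M.act ((add_assoc i j 1).symm.trans (congrArg (· + 1) h)) y x := rfl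

/-- The shift of a closed morphism. -/
def shiftMap {M N : DGModule C} (f : M ⟶ N) : M.shift ⟶ N.shift where
  app a i := f.app a (i + 1)
  app_d h x := by
    rw [shift_d, shift_d, map_neg, f.app_d]
  app_act h y x := by
    rw [shift_act, shift_act, map_smul, f.app_act]

/-- The component of a closed morphism in a degree `i`, as a map into the degree `j = i`. -/
def Hom.appTo {M N : DGModule C} (f : M ⟶ N) (a : C.Obj) {i j : ℤ} (h : i = j) :
    M.X a i →ₗ[k] N.X a j := h ▸ f.app a i

@[simp] theorem Hom.appTo_rfl {M N : DGModule C} (f : M ⟶ N) (a : C.Obj) (i : ℤ) :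
    Hom.appTo f a (rfl : i = i) = f.app a i := rfl

/-- The cone of a closed morphism `f : M ⟶ N`: the graded module `M[1] ⊕ N` with the
differential `(x, y) ↦ (-d x, f x + d y)`. -/
abbrev cone {M N : DGModule C} (f : M ⟶ N) : DGModule C where
  X a i := M.shift.X a i × N.X a i
  d a i j h := LinearMap.prod ((M.shift.d a h).comp (LinearMap.fst k _ _))
    ((Hom.appTo f a h).comp (LinearMap.fst k _ _) + (N.d a h).comp (LinearMap.snd k _ _))
  act h := LinearMap.mk₂ k (fun y x => (M.shift.act h y x.1, N.act h y x.2))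
    (by intros; simp) (by intros; simp) (by intros; simp) (by intros; simp)
  d_d {a i j l} h h' x := by
    subst h h'
    have := f.app_d (rfl : (i + 1) + 1 = i + 1 + 1) x.1
    refine Prod.ext (M.shift.d_d rfl rfl x.1) ?_
    change f.app a (i + 1 + 1) (M.shift.d a rfl x.1) +
      N.d a rfl (f.app a (i + 1) x.1 + N.d a rfl x.2) = 0
    rw [shift_d, map_neg, map_add, N.d_d, this, add_zero, neg_add_cancel]
  d_act {a b i j n i' j' n'} h hi hj hn h₁ h₂ y x := by
    subst hi hj hn
    have e := f.app_act (by omega : i + (j + 1) = n + 1) y x.1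
    refine Prod.ext (M.shift.d_act h rfl rfl rfl h₁ h₂ y x.1) ?_
    change f.app a (n + 1) (M.shift.act h y x.1) + N.d a rfl (N.act h y x.2) =
      N.act h₁ (C.d rfl y) x.2 + sgn k i • N.act h₂ y (f.app b (j + 1) x.1 + N.d b rfl x.2)
    rw [N.d_act h rfl rfl rfl h₁ h₂, shift_act, map_smul, e, map_add, smul_add]
    abel
  one_act h x := Prod.ext (M.shift.one_act h x.1) (N.one_act h x.2)
  comp_act h₁ h₂ h₃ h₄ f g x :=
    Prod.ext (M.shift.comp_act h₁ h₂ h₃ h₄ f g x.1) (N.comp_act h₁ h₂ h₃ h₄ f g x.2)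

theorem cone_d {M N : DGModule C} (f : M ⟶ N) (a : C.Obj) (i : ℤ)
    (x : M.X a (i + 1) × N.X a i) :
    (cone f).d a rfl x = (-M.d a rfl x.1, f.app a (i + 1) x.1 + N.d a rfl x.2) := rfl

theorem cone_act {M N : DGModule C} (f : M ⟶ N) {a b : C.Obj} {i j n : ℤ} (h : i + j = n)
    (y : C.Hom a b i) (x : M.X b (j + 1) × N.X b j) :
    (cone f).act h y x =
      (sgn k i • M.act ((add_assoc i j 1).symm.trans (congrArg (· + 1) h)) y x.1,
        N.act h y x.2) := rfl

/-- The inclusion of the target into the cone. -/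
def coneIn {M N : DGModule C} (f : M ⟶ N) : N ⟶ cone f where
  app a i := LinearMap.inr k (M.X a (i + 1)) (N.X a i)
  app_d {a i j} h x := by
    subst h
    rw [cone_d]
    simp
  app_act h y x := by
    rw [cone_act]
    simp

/-- The projection of the cone onto the shift of the source. -/
def coneOut {M N : DGModule C} (f : M ⟶ N) : cone f ⟶ M.shift where
  app a i := LinearMap.fst k (M.X a (i + 1)) (N.X a i)
  app_d {a i j} h x := by
    subst h
    rfl
  app_act h y x := rfl

/-- The morphism `cone f ⟶ P`, `(x, y) ↦ g y`, for composable `f`, `g` with `g f = 0`. -/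
def coneDesc {M N P : DGModule C} (f : M ⟶ N) (g : N ⟶ P)
    (w : ∀ (a : C.Obj) (i : ℤ) (x : M.X a i), g.app a i (f.app a i x) = 0) : cone f ⟶ P where
  app a i := (g.app a i).comp (LinearMap.snd k (M.X a (i + 1)) (N.X a i))
  app_d {a i j} h x := by
    subst h
    change g.app a (i + 1) (f.app a (i + 1) x.1 + N.d a rfl x.2) = P.d a rfl (g.app a i x.2)
    rw [map_add, w, g.app_d, zero_add]
  app_act h y x := g.app_act h y x.2

/-- The canonical isomorphism `(x, y) ↦ (-x, y)` from the cone of `f[1]` to the shift of the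
cone of `f`. -/
def coneShiftIso {M N : DGModule C} (f : M ⟶ N) : cone (shiftMap f) ≅ (cone f).shift where
  hom :=
    { app := fun a i => LinearMap.prodMap (-LinearMap.id : M.X a (i + 1 + 1) →ₗ[k] _)
        (LinearMap.id : N.X a (i + 1) →ₗ[k] _)
      app_d := fun {a i j} h x => by
        subst h
        refine Prod.ext (by simp) ?_
        change f.app a (i + 1 + 1) x.1 + -N.d a rfl x.2 =
          -(f.app a (i + 1 + 1) (-x.1) + N.d a rfl x.2)
        rw [map_neg, neg_add, neg_neg]
      app_act := fun {a b i j n} h y x => by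
        refine Prod.ext ?_ rfl
        subst h
        change -(sgn k i • (sgn k i • M.act _ y x.1)) = sgn k i • (sgn k i • M.act _ y (-x.1))
        rw [map_neg, smul_neg, smul_neg] }
  inv :=
    { app := fun a i => LinearMap.prodMap (-LinearMap.id : M.X a (i + 1 + 1) →ₗ[k] _)
        (LinearMap.id : N.X a (i + 1) →ₗ[k] _)
      app_d := fun {a i j} h x => by
        subst h
        refine Prod.ext (by simp) ?_
        change -(f.app a (i + 1 + 1) x.1 + N.d a rfl x.2) =
          f.app a (i + 1 + 1) (-x.1) + -N.d a rfl x.2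
        rw [map_neg, neg_add]
      app_act := fun {a b i j n} h y x => by
        refine Prod.ext ?_ rfl
        subst h
        change -(sgn k i • (sgn k i • M.act _ y x.1)) = sgn k i • (sgn k i • M.act _ y (-x.1))
        rw [map_neg, smul_neg, smul_neg] }
  hom_inv_id := hom_ext fun a i x => Prod.ext (neg_neg _) rfl
  inv_hom_id := hom_ext fun a i x => Prod.ext (neg_neg _) rfl

end DGModule

/-! ## The homotopy category, coacyclic modules, and the coderived category -/

variable (C : DGCategory k)

/-- The homotopy category of DG-modules over `C`. -/
abbrev Ho : Type (u + 1) := CategoryTheory.Quotient (DGModule.homotopic C)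

/-- The functor from DG-modules to the homotopy category. -/
abbrev toHo : DGModule C ⥤ Ho C := CategoryTheory.Quotient.functor (DGModule.homotopic C)

variable {C}

/-- An exact triple `0 ⟶ M ⟶ N ⟶ P ⟶ 0` of DG-modules and closed morphisms: exactness holds at
each object and in each degree. -/
structure IsExactTriple {M N P : DGModule C} (f : M ⟶ N) (g : N ⟶ P) : Prop where
  injective : ∀ (a : C.Obj) (i : ℤ), Function.Injective (f.app a i)
  zero : ∀ (a : C.Obj) (i : ℤ) (x : M.X a i), g.app a i (f.app a i x) = 0
  exact : ∀ (a : C.Obj) (i : ℤ) (y : N.X a i), g.app a i y = 0 → ∃ x, f.app a i x = y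
  surjective : ∀ (a : C.Obj) (i : ℤ), Function.Surjective (g.app a i)

/-- The coacyclic DG-modules: the smallest full triangulated subcategory of the homotopy
category that contains the totalizations of the exact triples and is closed under infinite
direct sums. (The totalization of `M ⟶ N ⟶ P` is, up to a shift, the cone of the induced
morphism `cone (M ⟶ N) ⟶ P`.) -/
inductive CoAcyclic : DGModule C → Prop
  | tot {M N P : DGModule C} (f : M ⟶ N) (g : N ⟶ P) (h : IsExactTriple f g) :
      CoAcyclic (DGModule.cone (DGModule.coneDesc f g h.zero))
  | iso {M N : DGModule C} (e : (toHo C).obj M ≅ (toHo C).obj N) :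
      CoAcyclic M → CoAcyclic N
  | shift {M : DGModule C} : CoAcyclic M → CoAcyclic M.shift
  | unshift {M : DGModule C} : CoAcyclic M.shift → CoAcyclic M
  | cone {M N : DGModule C} (f : M ⟶ N) :
      CoAcyclic M → CoAcyclic N → CoAcyclic (DGModule.cone f)
  | sum {ι : Type u} (M : ι → DGModule C) (c : Limits.Cofan fun i => (toHo C).obj (M i))
      (hc : Limits.IsColimit c) : (∀ i, CoAcyclic (M i)) → CoAcyclic c.pt.as

variable (C)

/-- The morphisms of the homotopy category that have a coacyclic cone. -/
def coWeq : MorphismProperty (Ho C) := fun X Y φ =>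
  ∃ f : X.as ⟶ Y.as, (toHo C).map f = φ ∧ CoAcyclic (DGModule.cone f)

/-- The coderived category: the Verdier quotient of the homotopy category by the coacyclic
DG-modules, that is, its localization at the morphisms with coacyclic cone. -/
abbrev Dco : Type (u + 1) := (coWeq C).Localization

/-- The functor from DG-modules to the coderived category. -/
abbrev toDco : DGModule C ⥤ Dco C := toHo C ⋙ (coWeq C).Q

/-- The shift functor on DG-modules. -/
def shiftFunctor : DGModule C ⥤ DGModule C where
  obj M := M.shift
  map f := DGModule.shiftMap f

/-- The shift of a homotopy. -/
def DGModule.Homotopy.shift {C : DGCategory k} {M N : DGModule C} {f g : M ⟶ N}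
    (H : DGModule.Homotopy f g) :
    DGModule.Homotopy (DGModule.shiftMap f) (DGModule.shiftMap g) where
  h a _ _ e := -H.h a (congrArg (· + 1) e)
  h_act {a b i j n j' n'} e ej en e' y x := by
    have := H.h_act ((add_assoc i j 1).symm.trans (congrArg (· + 1) e))
      (congrArg (· + 1) ej) (congrArg (· + 1) en)
      ((add_assoc i j' 1).symm.trans (congrArg (· + 1) e')) y x
    rw [DGModule.shift_act, DGModule.shift_act]
    simp only [LinearMap.neg_apply, map_smul, map_neg, this, smul_neg]
  comm {a i j l} e e' x := by
    rw [DGModule.shift_d]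
    have := H.comm (congrArg (· + 1) e) (congrArg (· + 1) e') x
    refine this.trans ?_
    rw [DGModule.shift_d]
    simp

/-- The shift functor on the homotopy category. -/
def shiftHo : Ho C ⥤ Ho C :=
  CategoryTheory.Quotient.lift _ (shiftFunctor C ⋙ toHo C)
    (fun _ _ _ _ ⟨H⟩ => CategoryTheory.Quotient.sound _ ⟨H.shift⟩)

theorem coWeq_shift : (coWeq C).IsInvertedBy (shiftHo C ⋙ (coWeq C).Q) := by
  rintro X Y _ ⟨f, rfl, hf⟩
  refine Localization.inverts (coWeq C).Q (coWeq C) _ ⟨DGModule.shiftMap f, rfl, ?_⟩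
  exact .iso ((toHo C).mapIso (DGModule.coneShiftIso f).symm) (.shift hf)

/-- The shift functor on the coderived category. -/
def shiftDco : Dco C ⥤ Dco C :=
  Localization.Construction.lift (shiftHo C ⋙ (coWeq C).Q) (coWeq_shift C)

variable {C}

/-- The distinguished triangles `X ⟶ Y ⟶ Z ⟶ X[1]` of the coderived category: those that are
isomorphic to the image of `M ⟶ N ⟶ cone f ⟶ M[1]` for a closed morphism `f : M ⟶ N`. -/
def IsDistinguished {X Y Z : Dco C} (p : X ⟶ Y) (q : Y ⟶ Z) (r : Z ⟶ (shiftDco C).obj X) :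
    Prop :=
  ∃ (M N : DGModule C) (f : M ⟶ N) (α : X ≅ (toDco C).obj M) (β : Y ≅ (toDco C).obj N)
    (γ : Z ≅ (toDco C).obj (DGModule.cone f)),
    p ≫ β.hom = α.hom ≫ (toDco C).map f ∧
    q ≫ γ.hom = β.hom ≫ (toDco C).map (DGModule.coneIn f) ∧
    r ≫ (shiftDco C).map α.hom = γ.hom ≫ (toDco C).map (DGModule.coneOut f)

/-- An equivalence of coderived categories, as triangulated categories: an equivalence of
categories that commutes with the shifts and preserves distinguished triangles. -/
structure CoderivedEquivalence (C D : DGCategory k) where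
  equiv : Dco C ≌ Dco D
  commShift : shiftDco C ⋙ equiv.functor ≅ equiv.functor ⋙ shiftDco D
  distinguished : ∀ {X Y Z : Dco C} (p : X ⟶ Y) (q : Y ⟶ Z) (r : Z ⟶ (shiftDco C).obj X),
    IsDistinguished p q r →
      IsDistinguished (equiv.functor.map p) (equiv.functor.map q)
        (equiv.functor.map r ≫ commShift.hom.app X)

end Modules

/-! ## Graded vector spaces -/

section Graded

variable (k : Type u) [Field k] {V : Type u} [AddCommGroup V] [Module k V]
  (gr : ℤ → Submodule k V) [DirectSum.Decomposition gr]

/-- The operator `v ↦ (-1) ^ |v| v` of a graded vector space. -/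
def signOp : V →ₗ[k] V :=
  (DirectSum.toModule k ℤ V fun i => sgn k i • (gr i).subtype).comp
    (DirectSum.decomposeLinearEquiv gr).toLinearMap

theorem signOp_apply {i : ℤ} {v : V} (hv : v ∈ gr i) : signOp k gr v = sgn k i • v := by
  simp only [signOp, LinearMap.comp_apply, LinearEquiv.coe_coe,
    DirectSum.decomposeLinearEquiv_apply]
  rw [DirectSum.decompose_of_mem gr hv, ← DirectSum.lof_eq_of k, DirectSum.toModule_lof]
  rfl

theorem iSup_graded : ⨆ i, gr i = ⊤ :=
  (DirectSum.Decomposition.isInternal gr).submodule_iSup_eq_top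

variable {gr} in
/-- Linear maps that agree on homogeneous elements are equal. -/
theorem graded_ext {W : Type*} [AddCommGroup W] [Module k W] {f g : V →ₗ[k] W}
    (h : ∀ (i : ℤ) (v : V), v ∈ gr i → f v = g v) : f = g := by
  rw [← LinearMap.eqLocus_eq_top, ← top_le_iff, ← iSup_graded k gr]
  exact iSup_le fun i v hv => h i v hv

theorem signOp_mem {i : ℤ} {v : V} (hv : v ∈ gr i) : signOp k gr v ∈ gr i := by
  rw [signOp_apply k gr hv]; exact Submodule.smul_mem _ _ hv

theorem signOp_signOp (v : V) : signOp k gr (signOp k gr v) = v := by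
  refine LinearMap.congr_fun (f := (signOp k gr).comp (signOp k gr)) (g := LinearMap.id)
    (graded_ext k (gr := gr) fun i v hv => ?_) v
  simp only [LinearMap.comp_apply]
  rw [signOp_apply k gr hv, map_smul, signOp_apply k gr hv, sgn_smul_sgn_smul]
  rfl

theorem d_signOp {d : V →ₗ[k] V} (hd : ∀ {n : ℤ} {v : V}, v ∈ gr n → d v ∈ gr (n + 1)) (v : V) :
    d (signOp k gr v) = -signOp k gr (d v) := by
  refine LinearMap.congr_fun (f := d.comp (signOp k gr)) (g := -(signOp k gr).comp d)
    (graded_ext k (gr := gr) fun i v hv => ?_) v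
  simp only [LinearMap.comp_apply, LinearMap.neg_apply]
  rw [signOp_apply k gr hv, map_smul, signOp_apply k gr (hd hv), sgn_succ, neg_smul, neg_neg]

/-- The degree `n` part of `V ⊗ V`, spanned by the `x ⊗ y` with `|x| + |y| = n`. -/
def tensorGr (n : ℤ) : Submodule k (V ⊗[k] V) :=
  Submodule.span k {z | ∃ (i j : ℤ) (x y : V), i + j = n ∧ x ∈ gr i ∧ y ∈ gr j ∧ z = x ⊗ₜ y}

theorem map_signOp {n : ℤ} {z : V ⊗[k] V} (hz : z ∈ tensorGr k gr n) :
    TensorProduct.map (signOp k gr) (signOp k gr) z = sgn k n • z := by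
  refine Submodule.span_le (p := LinearMap.eqLocus
    (TensorProduct.map (signOp k gr) (signOp k gr)) (sgn k n • LinearMap.id)) |>.2 ?_ hz
  rintro _ ⟨i, j, x, y, rfl, hx, hy, rfl⟩
  change TensorProduct.map (signOp k gr) (signOp k gr) (x ⊗ₜ y) = sgn k (i + j) • (x ⊗ₜ[k] y)
  rw [TensorProduct.map_tmul, signOp_apply k gr hx, signOp_apply k gr hy, sgn_add,
    TensorProduct.smul_tmul_smul]

end Graded

/-! ## DG-coalgebras and DG-bialgebras -/

/-- A DG-coalgebra over `k`, not necessarily counital: a graded vector space with a differential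
of degree `1` and a coassociative comultiplication of degree `0` that commutes with the
differentials. -/
structure DGCoalgebra (k : Type u) [Field k] where
  X : Type u
  [addCommGroup : AddCommGroup X]
  [module : Module k X]
  gr : ℤ → Submodule k X
  [decomposition : DirectSum.Decomposition gr]
  d : X →ₗ[k] X
  d_mem : ∀ {n : ℤ} {x : X}, x ∈ gr n → d x ∈ gr (n + 1)
  d_d : ∀ x, d (d x) = 0
  comul : X →ₗ[k] X ⊗[k] X
  comul_mem : ∀ {n : ℤ} {x : X}, x ∈ gr n → comul x ∈ tensorGr k gr n
  comul_d : ∀ x, comul (d x) = (TensorProduct.map d LinearMap.id (comul x) +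
    TensorProduct.map (signOp k gr) d (comul x))
  coassoc : ∀ x, TensorProduct.assoc k X X X (TensorProduct.map comul LinearMap.id (comul x)) =
    TensorProduct.map LinearMap.id comul (comul x)

attribute [instance] DGCoalgebra.addCommGroup DGCoalgebra.module DGCoalgebra.decomposition

/-- A (unital, counital) DG-bialgebra over `k`: a graded algebra and a coalgebra, with a
differential that makes it a DG-algebra and a DG-coalgebra, such that the comultiplication and
the counit are morphisms of graded algebras; here `A ⊗ A` has the multiplication
`(x ⊗ y) (x' ⊗ y') = (-1) ^ (|y| |x'|) x x' ⊗ y y'`. -/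
structure DGBialgebra (k : Type u) [Field k] where
  X : Type u
  [ring : Ring X]
  [algebra : Algebra k X]
  [coalgebra : Coalgebra k X]
  gr : ℤ → Submodule k X
  [graded : GradedAlgebra gr]
  d : X →ₗ[k] X
  d_mem : ∀ {n : ℤ} {x : X}, x ∈ gr n → d x ∈ gr (n + 1)
  d_d : ∀ x, d (d x) = 0
  d_mul : ∀ {n : ℤ} {x : X} (y : X), x ∈ gr n → d (x * y) = d x * y + sgn k n • (x * d y)
  comul_mem : ∀ {n : ℤ} {x : X}, x ∈ gr n → Coalgebra.comul x ∈ tensorGr k gr n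
  comul_d : ∀ x, Coalgebra.comul (d x) =
    TensorProduct.map d LinearMap.id (Coalgebra.comul (R := k) x) +
      TensorProduct.map (signOp k gr) d (Coalgebra.comul (R := k) x)
  counit_mem : ∀ {n : ℤ} {x : X}, x ∈ gr n → n ≠ 0 → Coalgebra.counit (R := k) x = 0
  counit_d : ∀ x, Coalgebra.counit (R := k) (d x) = 0
  comul_one : Coalgebra.comul (R := k) (1 : X) = 1 ⊗ₜ 1
  comul_mul : ∀ x y : X, GradedTensorProduct.of k gr gr (Coalgebra.comul (x * y)) =
    GradedTensorProduct.of k gr gr (Coalgebra.comul x) *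
      GradedTensorProduct.of k gr gr (Coalgebra.comul y)
  counit_one : Coalgebra.counit (R := k) (1 : X) = 1
  counit_mul : ∀ x y : X, Coalgebra.counit (R := k) (x * y) =
    Coalgebra.counit x * Coalgebra.counit (R := k) y

attribute [instance] DGBialgebra.ring DGBialgebra.algebra DGBialgebra.coalgebra
  DGBialgebra.graded

section Cobar

variable {k : Type u} [Field k]

/-- The underlying DG-coalgebra of a DG-bialgebra. -/
abbrev DGBialgebra.toDGCoalgebra (A : DGBialgebra k) : DGCoalgebra k where
  X := A.X
  gr := A.gr
  d := A.d
  d_mem := A.d_mem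
  d_d := A.d_d
  comul := Coalgebra.comul
  comul_mem := A.comul_mem
  comul_d := A.comul_d
  coassoc x := Coalgebra.coassoc_apply x

namespace DGCoalgebra

variable (C : DGCoalgebra k)

/-- The tensor algebra of `C`.  Its part of tensor length `n` is `C ^ ⊗ n`. -/
abbrev T : Type u := TensorAlgebra k C.X

/-- The embedding of the generators of the tensor algebra. An element of degree `e` of `C`
has degree `e + 1` as a generator, so that the space of generators is `C[-1]`. -/
abbrev gen : C.X →ₗ[k] C.T := TensorAlgebra.ι k

/-- The automorphism `x ↦ (-1) ^ |x| x` of the tensor algebra of `C[-1]`. -/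
def sigma : C.T →ₐ[k] C.T := TensorAlgebra.lift k (-C.gen.comp (signOp k C.gr))

@[simp] theorem sigma_gen (x : C.X) : C.sigma (C.gen x) = -C.gen (signOp k C.gr x) := by
  simp [sigma]

/-- Auxiliary algebra morphism to the upper triangular matrices `(σ, D; 0, id)`. -/
def derMatrix (δ : C.X →ₗ[k] C.T) : C.T →ₐ[k] Matrix (Fin 2) (Fin 2) C.T :=
  TensorAlgebra.lift k
    { toFun := fun x => !![C.sigma (C.gen x), δ x; 0, C.gen x]
      map_add' := fun x y => by ext i j; fin_cases i <;> fin_cases j <;> simp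
      map_smul' := fun c x => by ext i j; fin_cases i <;> fin_cases j <;> simp }

/-- The extension of `δ : C[-1] → T(C[-1])` to the tensor algebra by the graded Leibniz rule
`D (x y) = (D x) y + (-1) ^ |x| x (D y)`. -/
def der (δ : C.X →ₗ[k] C.T) : C.T →ₗ[k] C.T where
  toFun x := C.derMatrix δ x 0 1
  map_add' x y := by simp
  map_smul' c x := by simp

theorem derMatrix_apply (δ : C.X →ₗ[k] C.T) (x : C.T) :
    C.derMatrix δ x 0 0 = C.sigma x ∧ C.derMatrix δ x 1 0 = 0 ∧ C.derMatrix δ x 1 1 = x := by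
  induction x using TensorAlgebra.induction with
  | algebraMap r => simp [Matrix.algebraMap_matrix_apply]
  | ι x => simp [derMatrix]
  | mul x y hx hy => simp [Matrix.mul_apply, hx, hy]
  | add x y hx hy => simp [hx, hy]

@[simp] theorem der_gen (δ : C.X →ₗ[k] C.T) (x : C.X) : C.der δ (C.gen x) = δ x := by
  simp [der, derMatrix]

@[simp] theorem der_algebraMap (δ : C.X →ₗ[k] C.T) (r : k) :
    C.der δ (algebraMap k C.T r) = 0 := by
  simp [der, Matrix.algebraMap_matrix_apply]

theorem der_mul (δ : C.X →ₗ[k] C.T) (x y : C.T) :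
    C.der δ (x * y) = C.der δ x * y + C.sigma x * C.der δ y := by
  simp [der, Matrix.mul_apply, derMatrix_apply, add_comm]

theorem sigma_sigma (x : C.T) : C.sigma (C.sigma x) = x := by
  induction x using TensorAlgebra.induction with
  | algebraMap r => simp
  | ι x => simp [signOp_signOp]
  | mul x y hx hy => simp [hx, hy]
  | add x y hx hy => simp [hx, hy]

theorem sigma_der {δ : C.X →ₗ[k] C.T} (h : ∀ x, C.sigma (δ x) = δ (signOp k C.gr x)) (x : C.T) :
    C.sigma (C.der δ x) = -C.der δ (C.sigma x) := by
  induction x using TensorAlgebra.induction with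
  | algebraMap r => simp
  | ι x => simp [h]
  | mul x y hx hy => simp only [der_mul, map_add, map_mul, hx, hy]; noncomm_ring
  | add x y hx hy => simp only [map_add, hx, hy]; abel

theorem der_der {δ : C.X →ₗ[k] C.T} (h : ∀ x, C.sigma (δ x) = δ (signOp k C.gr x))
    (h0 : ∀ x, C.der δ (δ x) = 0) (x : C.T) : C.der δ (C.der δ x) = 0 := by
  induction x using TensorAlgebra.induction with
  | algebraMap r => simp
  | ι x => simp [h0]
  | mul x y hx hy =>
    simp only [der_mul, map_add, hx, hy, C.sigma_der h]; noncomm_ring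
  | add x y hx hy => simp [hx, hy]

theorem der_der_add {δ ε : C.X →ₗ[k] C.T} (h : ∀ x, C.sigma (δ x) = δ (signOp k C.gr x))
    (h' : ∀ x, C.sigma (ε x) = ε (signOp k C.gr x))
    (h0 : ∀ x, C.der δ (ε x) + C.der ε (δ x) = 0) (x : C.T) :
    C.der δ (C.der ε x) + C.der ε (C.der δ x) = 0 := by
  induction x using TensorAlgebra.induction with
  | algebraMap r => simp
  | ι x => simp [h0]
  | mul x y hx hy =>
    rw [add_eq_zero_iff_eq_neg] at hx hy ⊢
    simp only [der_mul, map_add, hx, hy, C.sigma_der h, C.sigma_der h']; noncomm_ring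
  | add x y hx hy =>
    rw [add_eq_zero_iff_eq_neg] at hx hy ⊢
    simp only [map_add, hx, hy]; abel

/-- The part of `T(C[-1])` of tensor length `n` and of degree `m`: it is spanned by the
products `c₁ ⋯ cₙ` of homogeneous elements with `∑ (|cᵢ| + 1) = m`. -/
def piece : ℕ → ℤ → Submodule k C.T
  | 0, m => if m = 0 then 1 else ⊥
  | n + 1, m => ⨆ e : ℤ, (C.gr e).map C.gen * piece n (m - (e + 1))

theorem gen_mul_mem {n : ℕ} {e m l : ℤ} (h : e + 1 + m = l) {x : C.X} (hx : x ∈ C.gr e)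
    {y : C.T} (hy : y ∈ C.piece n m) : C.gen x * y ∈ C.piece (n + 1) l := by
  have : m = l - (e + 1) := by omega
  subst this
  exact Submodule.mem_iSup_of_mem (p := fun e : ℤ => (C.gr e).map C.gen * C.piece n (l - (e + 1)))
    e (Submodule.mul_mem_mul (Submodule.mem_map_of_mem hx) hy)

theorem one_mem_piece : (1 : C.T) ∈ C.piece 0 0 := by
  rw [piece, if_pos rfl]
  exact Submodule.one_le.1 le_rfl

theorem gen_mem_piece {e m : ℤ} (h : e + 1 = m) {x : C.X} (hx : x ∈ C.gr e) :
    C.gen x ∈ C.piece 1 m := by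
  simpa using C.gen_mul_mem (by simpa using h) hx C.one_mem_piece

/-- Induction principle for the elements of the pieces. -/
theorem piece_le {P : ℕ → ℤ → Submodule k C.T} (h0 : (1 : C.T) ∈ P 0 0)
    (hs : ∀ (n : ℕ) (e m : ℤ) (x : C.X) (y : C.T), x ∈ C.gr e → y ∈ C.piece n m → y ∈ P n m →
      C.gen x * y ∈ P (n + 1) (e + 1 + m)) (n : ℕ) (m : ℤ) : C.piece n m ≤ P n m := by
  induction n generalizing m with
  | zero =>
    by_cases h : m = 0
    · subst h
      simpa [piece, Submodule.one_le] using h0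
    · simp [piece, h]
  | succ n ih =>
    refine iSup_le fun e => Submodule.mul_le.2 ?_
    rintro _ ⟨x, hx, rfl⟩ y hy
    have := hs n e _ x y hx hy (ih _ hy)
    rwa [add_sub_cancel] at this

theorem piece_mul_mem {n n' : ℕ} {m m' : ℤ} {x y : C.T} (hx : x ∈ C.piece n m)
    (hy : y ∈ C.piece n' m') : x * y ∈ C.piece (n + n') (m + m') := by
  refine C.piece_le
    (P := fun n m => (C.piece (n + n') (m + m')).comap (LinearMap.mulRight k y)) ?_ ?_ n m hx
  · simpa using hy
  · intro n e m x z hx _ hz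
    simp only [Submodule.mem_comap, LinearMap.mulRight_apply] at hz ⊢
    rw [mul_assoc, show n + 1 + n' = n + n' + 1 by omega]
    exact C.gen_mul_mem (by ring) hx hz

theorem sigma_piece {n : ℕ} {m : ℤ} {x : C.T} (hx : x ∈ C.piece n m) :
    C.sigma x = sgn k m • x := by
  refine C.piece_le
    (P := fun n m => LinearMap.eqLocus C.sigma.toLinearMap (sgn k m • LinearMap.id)) ?_ ?_ n m hx
  · simp [LinearMap.mem_eqLocus]
  · intro n e m x y hx _ hy
    simp only [LinearMap.mem_eqLocus, AlgHom.toLinearMap_apply, LinearMap.smul_apply,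
      LinearMap.id_apply] at hy ⊢
    rw [map_mul, hy, sigma_gen, signOp_apply k C.gr hx, map_smul, add_right_comm, sgn_succ,
      sgn_add, neg_mul, neg_smul, smul_mul_smul_comm]

theorem der_piece {δ : C.X →ₗ[k] C.T} {r : ℕ}
    (hδ : ∀ (e : ℤ) (x : C.X), x ∈ C.gr e → δ x ∈ C.piece (r + 1) (e + 1 + 1)) {n : ℕ} {m : ℤ}
    {x : C.T} (hx : x ∈ C.piece n m) : C.der δ x ∈ C.piece (n + r) (m + 1) := by
  refine C.piece_le (P := fun n m => (C.piece (n + r) (m + 1)).comap (C.der δ)) ?_ ?_ n m hx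
  · have := C.der_algebraMap δ 1
    rw [map_one] at this
    simp [this]
  · intro n e m x y hx hy hy'
    simp only [Submodule.mem_comap] at hy' ⊢
    rw [der_mul, der_gen]
    refine Submodule.add_mem _ ?_ ?_
    · have := C.piece_mul_mem (hδ e x hx) hy
      rwa [show r + 1 + n = n + 1 + r by omega,
        show e + 1 + 1 + m = e + 1 + m + 1 by omega] at this
    · rw [sigma_gen, ← map_neg, show n + 1 + r = n + r + 1 by omega]
      exact C.gen_mul_mem (by ring) (Submodule.neg_mem _ (signOp_mem k C.gr hx)) hy'

/-- The map `x ⊗ y ↦ (-1) ^ (|x| + 1) x y` from `C ⊗ C` to the tensor algebra of `C[-1]`. -/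
def quad : C.X ⊗[k] C.X →ₗ[k] C.T :=
  -(LinearMap.mul' k C.T).comp (TensorProduct.map (C.gen.comp (signOp k C.gr)) C.gen)

@[simp] theorem quad_tmul (x y : C.X) :
    C.quad (x ⊗ₜ y) = -(C.gen (signOp k C.gr x) * C.gen y) := by
  simp [quad]

/-- The part of the Cobar differential that preserves the tensor length: on generators it is
the differential of `C[-1]`, that is, `x ↦ -d x`. -/
def dLin : C.T →ₗ[k] C.T := C.der (-C.gen.comp C.d)

/-- The part of the Cobar differential that raises the tensor length by one: on generators it
is the comultiplication, `x ↦ ∑ (-1) ^ (|x'| + 1) x' x''`. -/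
def dQuad : C.T →ₗ[k] C.T := C.der (C.quad.comp C.comul)

theorem sigma_lin (x : C.X) : C.sigma ((-C.gen.comp C.d) x) =
    (-C.gen.comp C.d) (signOp k C.gr x) := by
  simp [d_signOp k C.gr C.d_mem]

theorem comul_signOp (x : C.X) : C.comul (signOp k C.gr x) =
    TensorProduct.map (signOp k C.gr) (signOp k C.gr) (C.comul x) := by
  refine LinearMap.congr_fun (f := C.comul.comp (signOp k C.gr))
    (g := (TensorProduct.map (signOp k C.gr) (signOp k C.gr)).comp C.comul)
    (graded_ext k (gr := C.gr) fun i v hv => ?_) x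
  simp only [LinearMap.comp_apply]
  rw [signOp_apply k C.gr hv, map_smul, map_signOp k C.gr (C.comul_mem hv)]

theorem sigma_quad (x : C.X) : C.sigma ((C.quad.comp C.comul) x) =
    (C.quad.comp C.comul) (signOp k C.gr x) := by
  simp only [LinearMap.comp_apply, comul_signOp]
  induction C.comul x using TensorProduct.induction_on with
  | zero => simp
  | tmul x y => simp
  | add x y hx hy => simp [hx, hy]

theorem dLin_dLin (x : C.T) : C.dLin (C.dLin x) = 0 :=
  C.der_der C.sigma_lin (fun x => by simp [C.d_d]) x

theorem dLin_dQuad (x : C.T) : C.dLin (C.dQuad x) + C.dQuad (C.dLin x) = 0 := by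
  refine C.der_der_add C.sigma_lin C.sigma_quad (fun x => ?_) x
  simp only [LinearMap.neg_apply, LinearMap.comp_apply, map_neg, der_gen, C.comul_d, map_add]
  induction C.comul x using TensorProduct.induction_on with
  | zero => simp
  | tmul x y =>
    simp [der_mul, d_signOp k C.gr C.d_mem, signOp_signOp]
    abel
  | add x y hx hy =>
    rw [add_neg_eq_zero] at hx hy ⊢
    simp only [map_add, hx, hy]
    abel

theorem dQuad_dQuad (x : C.T) : C.dQuad (C.dQuad x) = 0 := by
  refine C.der_der C.sigma_quad (fun x => ?_) x
  let F : (C.X ⊗[k] C.X) ⊗[k] C.X →ₗ[k] C.T :=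
    (LinearMap.mul' k C.T).comp (TensorProduct.map
      (C.quad.comp (TensorProduct.map (signOp k C.gr) (signOp k C.gr))) C.gen)
  let G : C.X ⊗[k] (C.X ⊗[k] C.X) →ₗ[k] C.T :=
    (LinearMap.mul' k C.T).comp (TensorProduct.map C.gen C.quad)
  have hFG : ∀ w, F w = G (TensorProduct.assoc k C.X C.X C.X w) := fun w => by
    refine LinearMap.congr_fun (f := F)
      (g := G.comp (TensorProduct.assoc k C.X C.X C.X).toLinearMap)
      (TensorProduct.ext_threefold fun x y z => ?_) w
    simp [F, G, signOp_signOp, mul_assoc]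
  have key : ∀ z : C.X ⊗[k] C.X, C.der (C.quad.comp C.comul) (C.quad z) =
      G (TensorProduct.map LinearMap.id C.comul z) -
        F (TensorProduct.map C.comul LinearMap.id z) := fun z => by
    induction z using TensorProduct.induction_on with
    | zero => simp
    | tmul x y => simp [der_mul, F, G, comul_signOp, signOp_signOp, sub_eq_add_neg, add_comm]
    | add x y hx hy => simp only [map_add, hx, hy]; abel
  rw [LinearMap.comp_apply, key, hFG, C.coassoc, sub_self]

theorem dLin_piece {n : ℕ} {m : ℤ} {x : C.T} (hx : x ∈ C.piece n m) :
    C.dLin x ∈ C.piece n (m + 1) :=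
  C.der_piece (r := 0) (fun e x hx => by
    simpa using C.gen_mem_piece rfl (C.d_mem hx)) hx

theorem dQuad_piece {n : ℕ} {m : ℤ} {x : C.T} (hx : x ∈ C.piece n m) :
    C.dQuad x ∈ C.piece (n + 1) (m + 1) := by
  refine C.der_piece (r := 1) (fun e x hx => ?_) hx
  refine Submodule.span_le (p := (C.piece 2 (e + 1 + 1)).comap C.quad) |>.2 ?_ (C.comul_mem hx)
  rintro _ ⟨i, j, x, y, rfl, hx, hy, rfl⟩
  simp only [SetLike.mem_coe, Submodule.mem_comap, quad_tmul]
  exact Submodule.neg_mem _ (C.gen_mul_mem (by ring) (signOp_mem k C.gr hx)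
    (C.gen_mem_piece rfl hy))

open PowerSeries in
/-- Apply a linear endomorphism of the tensor algebra to each component of a sequence. -/
def mapCoeff (f : C.T →ₗ[k] C.T) : PowerSeries C.T →ₗ[k] PowerSeries C.T where
  toFun x := PowerSeries.mk fun n => f (coeff n x)
  map_add' x y := by ext; simp
  map_smul' c x := by ext; simp

@[simp] theorem coeff_mapCoeff (f : C.T →ₗ[k] C.T) (n : ℕ) (x : PowerSeries C.T) :
    PowerSeries.coeff n (C.mapCoeff f x) = f (PowerSeries.coeff n x) := by
  simp [mapCoeff]

/-- The degree `m` part of the completed tensor algebra `∏ₙ C[-1] ^ ⊗ n`.  A sequence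
`(x₀, x₁, …)` of elements `xₙ` of `C[-1] ^ ⊗ n` of degree `m` is encoded as the power series
`∑ xₙ tⁿ` over the tensor algebra, so that the product of sequences is that of power series. -/
def cobarPiece (m : ℤ) : Submodule k (PowerSeries C.T) where
  carrier := {x | ∀ n, PowerSeries.coeff n x ∈ C.piece n m}
  add_mem' hx hy n := by
    rw [map_add]; exact Submodule.add_mem _ (hx n) (hy n)
  zero_mem' n := by
    rw [map_zero]; exact Submodule.zero_mem _
  smul_mem' c x hx n := by
    have : PowerSeries.coeff n (c • x) = c • PowerSeries.coeff n x := by simp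
    rw [this]; exact Submodule.smul_mem _ _ (hx n)

theorem one_mem_cobarPiece : (1 : PowerSeries C.T) ∈ C.cobarPiece 0 := fun n => by
  rw [PowerSeries.coeff_one]
  split_ifs with h
  · subst h; exact C.one_mem_piece
  · exact Submodule.zero_mem _

theorem mul_mem_cobarPiece {i j n : ℤ} (h : i + j = n) {x y : PowerSeries C.T}
    (hx : x ∈ C.cobarPiece i) (hy : y ∈ C.cobarPiece j) : x * y ∈ C.cobarPiece n := fun l => by
  subst h
  rw [PowerSeries.coeff_mul]
  refine Submodule.sum_mem _ fun p hp => ?_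
  rw [← Finset.HasAntidiagonal.mem_antidiagonal.1 hp]
  exact C.piece_mul_mem (hx _) (hy _)

/-- The Cobar differential: `(d x)ₙ = dLin xₙ + dQuad xₙ₋₁`. -/
def cobarD : PowerSeries C.T →ₗ[k] PowerSeries C.T :=
  C.mapCoeff C.dLin + (LinearMap.mulLeft k PowerSeries.X).comp (C.mapCoeff C.dQuad)

theorem cobarD_apply (x : PowerSeries C.T) :
    C.cobarD x = C.mapCoeff C.dLin x + PowerSeries.X * C.mapCoeff C.dQuad x := rfl

theorem cobarD_mem {i j : ℤ} (h : i + 1 = j) {x : PowerSeries C.T} (hx : x ∈ C.cobarPiece i) :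
    C.cobarD x ∈ C.cobarPiece j := fun n => by
  subst h
  rw [cobarD_apply, map_add]
  refine Submodule.add_mem _ ?_ ?_
  · rw [coeff_mapCoeff]; exact C.dLin_piece (hx n)
  · cases n with
    | zero => simp
    | succ n =>
      rw [PowerSeries.coeff_succ_X_mul, coeff_mapCoeff]
      exact C.dQuad_piece (hx n)

theorem mapCoeff_X_mul (f : C.T →ₗ[k] C.T) (x : PowerSeries C.T) :
    C.mapCoeff f (PowerSeries.X * x) = PowerSeries.X * C.mapCoeff f x := by
  ext n
  cases n with
  | zero => simp
  | succ n => rw [coeff_mapCoeff, PowerSeries.coeff_succ_X_mul, PowerSeries.coeff_succ_X_mul,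
      coeff_mapCoeff]

theorem cobarD_cobarD (x : PowerSeries C.T) : C.cobarD (C.cobarD x) = 0 := by
  simp only [cobarD_apply, map_add, mapCoeff_X_mul]
  have h1 : C.mapCoeff C.dLin (C.mapCoeff C.dLin x) = 0 := by
    ext; simp [C.dLin_dLin]
  have h2 : C.mapCoeff C.dQuad (C.mapCoeff C.dQuad x) = 0 := by
    ext; simp [C.dQuad_dQuad]
  have h3 : C.mapCoeff C.dLin (C.mapCoeff C.dQuad x) + C.mapCoeff C.dQuad (C.mapCoeff C.dLin x)
      = 0 := by
    ext n
    simp only [map_add, coeff_mapCoeff, C.dLin_dQuad, map_zero]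
  rw [h1, h2, mul_zero, mul_zero, zero_add, add_zero, ← mul_add, add_comm, h3, mul_zero]

theorem mapCoeff_der_mul (δ : C.X →ₗ[k] C.T) {i : ℤ} {x : PowerSeries C.T}
    (hx : x ∈ C.cobarPiece i) (y : PowerSeries C.T) :
    C.mapCoeff (C.der δ) (x * y) =
      C.mapCoeff (C.der δ) x * y + sgn k i • (x * C.mapCoeff (C.der δ) y) := by
  ext n
  have : ∀ z : PowerSeries C.T, PowerSeries.coeff n (sgn k i • z) =
      sgn k i • PowerSeries.coeff n z := fun z => by simp
  rw [map_add, this]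
  simp only [coeff_mapCoeff, PowerSeries.coeff_mul, map_sum, Finset.smul_sum,
    ← Finset.sum_add_distrib]
  refine Finset.sum_congr rfl fun p _ => ?_
  rw [der_mul, C.sigma_piece (hx p.1), smul_mul_assoc]

theorem cobarD_mul {i : ℤ} {x : PowerSeries C.T} (hx : x ∈ C.cobarPiece i)
    (y : PowerSeries C.T) :
    C.cobarD (x * y) = C.cobarD x * y + sgn k i • (x * C.cobarD y) := by
  simp only [cobarD_apply]
  rw [dLin, dQuad, C.mapCoeff_der_mul _ hx, C.mapCoeff_der_mul _ hx]
  simp only [mul_add, add_mul, smul_add, mul_assoc, mul_smul_comm]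
  rw [← mul_assoc x PowerSeries.X, ← PowerSeries.X_mul, mul_assoc]
  abel

/-- The Cobar construction `Cobar(C) = ∏ₙ C[-1] ^ ⊗ n` of a DG-coalgebra: the completed tensor
algebra of `C[-1]`, with the differential that is `d + Δ` on the generators and extends by the
Leibniz rule. -/
def cobar : DGAlgebra k where
  X m := C.cobarPiece m
  d h := LinearMap.restrict C.cobarD fun _ hx => C.cobarD_mem h hx
  one := ⟨1, C.one_mem_cobarPiece⟩
  mul h := LinearMap.mk₂ k (fun x y => ⟨x.1 * y.1, C.mul_mem_cobarPiece h x.2 y.2⟩)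
    (fun _ _ _ => Subtype.ext (add_mul _ _ _)) (fun _ _ _ => Subtype.ext (smul_mul_assoc _ _ _))
    (fun _ _ _ => Subtype.ext (mul_add _ _ _)) (fun _ _ _ => Subtype.ext (mul_smul_comm _ _ _))
  d_d _ _ x := Subtype.ext (C.cobarD_cobarD x.1)
  d_mul _ _ _ _ _ _ x y := Subtype.ext (C.cobarD_mul x.2 y.1)
  one_mul _ x := Subtype.ext (one_mul x.1)
  mul_one _ x := Subtype.ext (mul_one x.1)
  assoc _ _ _ _ x y z := Subtype.ext (mul_assoc x.1 y.1 z.1)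

/-- The Maurer-Cartan equation in components:
`dLin xₙ + dQuad xₙ₋₁ + ∑ xᵢ xₙ₋ᵢ = 0` for every `n`. -/
theorem cobar_isMaurerCartan_iff (x : PowerSeries C.T) (hx : x ∈ C.cobarPiece 1) :
    C.cobar.IsMaurerCartan ⟨x, hx⟩ ↔ ∀ n : ℕ, C.dLin (PowerSeries.coeff n x) +
      (if n = 0 then 0 else C.dQuad (PowerSeries.coeff (n - 1) x)) +
      ∑ p ∈ Finset.HasAntidiagonal.antidiagonal n,
        PowerSeries.coeff p.1 x * PowerSeries.coeff p.2 x = 0 := by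
  have h : C.cobar.IsMaurerCartan ⟨x, hx⟩ ↔ C.cobarD x + x * x = 0 := Subtype.ext_iff
  rw [h, PowerSeries.ext_iff]
  refine forall_congr' fun n => ?_
  rw [map_add, cobarD_apply, map_add, coeff_mapCoeff, map_zero]
  cases n with
  | zero => simp
  | succ n => rw [PowerSeries.coeff_succ_X_mul, coeff_mapCoeff, PowerSeries.coeff_mul]; simp

end DGCoalgebra

namespace DGBialgebra

variable (A : DGBialgebra k)

theorem d_one : A.d 1 = 0 := by
  have := A.d_mul (1 : A.X) (SetLike.GradedOne.one_mem (A := A.gr) : (1 : A.X) ∈ A.gr 0)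
  simpa using this

theorem signOp_one : signOp k A.gr 1 = 1 := by
  rw [signOp_apply k A.gr (SetLike.GradedOne.one_mem (A := A.gr) : (1 : A.X) ∈ A.gr 0)]; simp

/-- The map `x ↦ Δ x - 1 ⊗ x - x ⊗ 1`. -/
def comulBar : A.X →ₗ[k] A.X ⊗[k] A.X :=
  Coalgebra.comul - TensorProduct.mk k A.X A.X 1 - (TensorProduct.mk k A.X A.X).flip 1

theorem comulBar_apply (x : A.X) :
    A.comulBar x = Coalgebra.comul (R := k) x - 1 ⊗ₜ x - x ⊗ₜ 1 := rfl

/-- `A` with the (non-counital) comultiplication `x ↦ Δ x - 1 ⊗ x - x ⊗ 1`. -/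
abbrev barCoalgebra : DGCoalgebra k where
  X := A.X
  gr := A.gr
  d := A.d
  d_mem := A.d_mem
  d_d := A.d_d
  comul := A.comulBar
  comul_mem {n x} hx := by
    have h1 : (1 : A.X) ∈ A.gr 0 := SetLike.GradedOne.one_mem
    refine Submodule.sub_mem _ (Submodule.sub_mem _ (A.comul_mem hx) ?_) ?_
    · exact Submodule.subset_span ⟨0, n, 1, x, by simp, h1, hx, rfl⟩
    · exact Submodule.subset_span ⟨n, 0, x, 1, by simp, hx, h1, rfl⟩
  comul_d x := by
    simp only [comulBar_apply, A.comul_d, map_sub, TensorProduct.map_tmul, A.d_one,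
      A.signOp_one, LinearMap.id_apply, TensorProduct.zero_tmul, TensorProduct.tmul_zero]
    abel
  coassoc x := by
    have h1 : ∀ z : A.X ⊗[k] A.X, TensorProduct.assoc k A.X A.X A.X
        (TensorProduct.map A.comulBar LinearMap.id z) =
        TensorProduct.assoc k A.X A.X A.X
          (TensorProduct.map (Coalgebra.comul (R := k)) LinearMap.id z) - 1 ⊗ₜ z -
        TensorProduct.map LinearMap.id (TensorProduct.mk k A.X A.X 1) z := fun z => by
      induction z using TensorProduct.induction_on with
      | zero => simp
      | tmul x y => simp [comulBar_apply, TensorProduct.sub_tmul]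
      | add x y hx hy => simp only [map_add, hx, hy, TensorProduct.tmul_add]; abel
    have h2 : ∀ z : A.X ⊗[k] A.X, TensorProduct.map LinearMap.id A.comulBar z =
        TensorProduct.map LinearMap.id (Coalgebra.comul (R := k)) z -
        TensorProduct.map LinearMap.id (TensorProduct.mk k A.X A.X 1) z -
        TensorProduct.assoc k A.X A.X A.X (z ⊗ₜ 1) := fun z => by
      induction z using TensorProduct.induction_on with
      | zero => simp
      | tmul x y => simp [comulBar_apply, TensorProduct.tmul_sub]
      | add x y hx hy => simp only [map_add, hx, hy, TensorProduct.add_tmul]; abel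
    have h3 := Coalgebra.coassoc_apply (R := k) x
    rw [h1, h2, comulBar_apply]
    simp only [map_sub, TensorProduct.map_tmul, LinearMap.id_apply, TensorProduct.tmul_sub,
      TensorProduct.sub_tmul, TensorProduct.mk_apply, TensorProduct.assoc_tmul, A.comul_one]
    change TensorProduct.assoc k A.X A.X A.X (TensorProduct.map (Coalgebra.comul (R := k))
      LinearMap.id (Coalgebra.comul (R := k) x)) = TensorProduct.map LinearMap.id
      (Coalgebra.comul (R := k)) (Coalgebra.comul (R := k) x) at h3
    rw [h3]
    abel

/-- The reduced (coaugmented) Cobar construction of `A`: the completed tensor algebra of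
`A[-1]`, with the differential that is `d + Δ + 1 ⊗ id - id ⊗ 1` on the generators, with the
Koszul signs of `A[-1]`, and extends by the Leibniz rule. -/
def cobarCoaug : DGAlgebra k := A.barCoalgebra.cobar

/-- On generators, the reduced Cobar differential is `d + Δ + 1 ⊗ id - id ⊗ 1`: the last two
terms form the graded commutator with the generator `1`, of degree `1`. -/
theorem barCoalgebra_dQuad (x : A.X) :
    (A.barCoalgebra.dQuad (TensorAlgebra.ι k (M := A.X) x) : TensorAlgebra k A.X) =
      (A.toDGCoalgebra.dQuad (TensorAlgebra.ι k (M := A.X) x) : TensorAlgebra k A.X) +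
      TensorAlgebra.ι k (1 : A.X) * TensorAlgebra.ι k x +
      TensorAlgebra.ι k (signOp k A.gr x) * TensorAlgebra.ι k (1 : A.X) := by
  have h1 := A.barCoalgebra.der_gen (A.barCoalgebra.quad.comp A.barCoalgebra.comul) x
  have h2 := A.toDGCoalgebra.der_gen (A.toDGCoalgebra.quad.comp A.toDGCoalgebra.comul) x
  refine h1.trans ?_
  refine Eq.trans ?_ (congrArg (fun w : TensorAlgebra k A.X => w + _ + _) h2.symm)
  have h3 := A.barCoalgebra.quad_tmul (1 : A.X) x
  have h4 := A.barCoalgebra.quad_tmul x (1 : A.X)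
  have h5 : signOp k A.barCoalgebra.gr (1 : A.X) = (1 : A.X) := A.signOp_one
  rw [h5] at h3
  refine (map_sub A.barCoalgebra.quad _ _).trans ?_
  refine (congrArg₂ (· - ·) (map_sub A.barCoalgebra.quad _ _) h4).trans ?_
  refine (congrArg (fun w => _ - w - _) h3).trans ?_
  rw [sub_neg_eq_add, sub_neg_eq_add]
  rfl

/-- An element `x` of `A` of degree `0` is homotopy invertible: it is closed and its class in
`H⁰(A)` is invertible. -/
def IsHomotopyInvertible (x : A.X) : Prop :=
  x ∈ A.gr 0 ∧ A.d x = 0 ∧ ∃ y ∈ A.gr 0, A.d y = 0 ∧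
    (∃ z ∈ A.gr (-1), x * y - 1 = A.d z) ∧ ∃ z ∈ A.gr (-1), y * x - 1 = A.d z

/-- The homotopy limit of the cosimplicial system of DG-algebras `k ⇉ A ⇶ A ⊗ A ⋯`, in the
category of DG-categories. Its objects are the sequences `a = (a₁, a₂, …)`, with `aₙ` in
`A ^ ⊗ n` of degree `1 - n` and `a₁` homotopy invertible, that satisfy the Maurer-Cartan
equation in `Cobar(A)`; the complex of morphisms from `a` to `b` is `Cobar(A)` with the
differential `f ↦ d f + a f - (-1) ^ |f| f b`, and the composition is the multiplication. -/
def holim : DGCategory k :=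
  A.toDGCoalgebra.cobar.MC.full fun a =>
    ∃ x : A.X, A.IsHomotopyInvertible x ∧
      PowerSeries.coeff 1 a.1.1 = TensorAlgebra.ι k (M := A.X) x

end DGBialgebra

end Cobar

end HomotopyCharacters

end

noncomputable section

namespace HomotopyCharacters

variable {k : Type u} [Field k]

/-! All Hom spaces of the homotopy limit have the same underlying graded space `Cobar(A)`; only the
differential depends on the two Maurer-Cartan elements. The element `s1` is itself an object: `Δ 1 =
1 ⊗ 1` and `d 1 = 0` give `d(s1) + (s1)² = 0`, and its first component `1` is invertible. The
differential of its endomorphism algebra is `d + [s1, -]`, which is exactly the reduced Cobar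
differential, so `End(s1)` is `Cobar_coaug(A)`.

For any object `a`, the unit of `Cobar(A)`, read as a morphism `a → s1` of degree `0`, is
invertible. It is not closed: its differential is `a - s1`. Hence, as graded categories, the
homotopy limit and the one-object category of `Cobar(A)` are equivalent, although as DG-categories
they need not be. A DG-module `M` is still determined by its value at `s1`: acting by these
invertible elements identifies `M(a)` with `M(s1)` carrying the differential `d + (a - s1)`.
Conversely, a DG-module over `Cobar_coaug(A)` produces all these complexes, because `a - s1`
satisfies the Maurer-Cartan equation for the reduced differential.

The formal notion behind this is a DG-functor up to a Maurer-Cartan twist (`TwistedFunctor`), along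
which modules restrict by adding the action of the twist to the differential. Two such functors that
are inverse up to invertible, possibly non-closed elements (`TwistedUnit`) give inverse equivalences
of module categories. Restriction leaves the underlying graded modules and maps alone, so it
respects exact triples, shifts, cones and homotopies. Twisting may change cohomology, so acyclicity
need not survive; coacyclicity does, since it is generated by the operations just named together
with direct sums (`coAcyclic_restr`). The equivalence therefore descends to the Verdier quotients
with its triangulated structure. The notion is self-dual, which gives right modules. -/

theorem DGCategory.d_one (C : DGCategory k) (a : C.Obj) {j : ℤ} (h : 0 + 1 = j) :
    C.d h (C.one a) = 0 := by
  subst h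
  have := C.d_comp (add_zero 0) rfl rfl rfl rfl (by norm_num) (C.one a) (C.one a)
  rw [C.one_comp, C.comp_one, C.one_comp] at this
  simpa using this

/-! ### Twisted functors and restriction of DG-modules -/

/-- A twisted DG-functor `D → C`: a functor of graded categories together with elements
`twist a` of degree `1` that satisfy the Maurer-Cartan equation, which commutes with the
differentials up to the twist. -/
structure TwistedFunctor (D C : DGCategory k) where
  obj : D.Obj → C.Obj
  map : ∀ {a b : D.Obj} {i : ℤ}, D.Hom a b i →ₗ[k] C.Hom (obj a) (obj b) i
  twist : ∀ a : D.Obj, C.Hom (obj a) (obj a) 1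
  map_one : ∀ a : D.Obj, map (D.one a) = C.one (obj a)
  map_comp : ∀ {a b c : D.Obj} {i j n : ℤ} (h : i + j = n) (f : D.Hom a b i) (g : D.Hom b c j),
    map (D.comp h f g) = C.comp h (map f) (map g)
  map_d : ∀ {a b : D.Obj} {i j : ℤ} (h : i + 1 = j) (h' : 1 + i = j) (f : D.Hom a b i),
    map (D.d h f) = C.d h (map f) + C.comp h' (twist a) (map f) -
      sgn k i • C.comp h (map f) (twist b)
  maurerCartan : ∀ (a : D.Obj) (h : (1 : ℤ) + 1 = 2),
    C.d h (twist a) + C.comp h (twist a) (twist a) = 0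

namespace TwistedFunctor

variable {C D : DGCategory k}

/-- The opposite twisted functor. -/
def op (G : TwistedFunctor D C) : TwistedFunctor D.op C.op where
  obj := G.obj
  map := G.map
  -- The product of two elements of degree `1` changes sign in the opposite category, so the
  -- Maurer-Cartan equation survives only for the negated twist.
  twist a := -G.twist a
  map_one := G.map_one
  map_comp := fun {a b c : D.Obj} {i j n} h (f : D.Hom b a i) (g : D.Hom c b j) => by
    change G.map (sgn k (i * j) • D.comp ((add_comm j i).trans h) g f) =
      sgn k (i * j) • C.comp ((add_comm j i).trans h) (G.map g) (G.map f)
    rw [map_smul, G.map_comp]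
  map_d := fun {a b : D.Obj} {i j} h h' (f : D.Hom b a i) => by
    change G.map (D.d h f) = C.d h (G.map f) +
      sgn k (1 * i) • C.comp h (G.map f) (-G.twist a) -
        sgn k i • sgn k (i * 1) • C.comp h' (-G.twist b) (G.map f)
    rw [G.map_d h h' f]
    simp only [map_neg, LinearMap.neg_apply, one_mul, mul_one, smul_neg, sgn_smul_sgn_smul]
    abel
  maurerCartan := fun (a : D.Obj) h => by
    have := G.maurerCartan a h
    change C.d h (-G.twist a) + sgn k (1 * 1) • C.comp h (-G.twist a) (-G.twist a) = 0
    simp only [map_neg, LinearMap.neg_apply, one_mul, sgn_one, neg_neg, neg_smul, one_smul]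
    rw [← neg_add, this, neg_zero]

/-- The restriction of a DG-module along a twisted functor. -/
abbrev restr (G : TwistedFunctor D C) (M : DGModule C) : DGModule D where
  X a i := M.X (G.obj a) i
  d a _ _ h := M.d (G.obj a) h + M.act ((add_comm 1 _).trans h) (G.twist a)
  act h := (M.act h).comp G.map
  d_d {a i j l} h h' x := by
    subst h h'
    -- With `t` the twist, `(d + t)² x = (d t + t²) x`: the terms `t (d x)` cancel by the Leibniz
    -- rule, and the Maurer-Cartan equation kills the rest.
    have hm := G.maurerCartan a (by norm_num)
    rw [add_eq_zero_iff_eq_neg] at hm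
    simp only [LinearMap.add_apply, map_add]
    rw [M.d_d, M.d_act (by omega : 1 + i = i + 1) (by norm_num : (1 : ℤ) + 1 = 2) rfl rfl
      (by omega) (by omega), hm, ← M.comp_act (by norm_num : (1 : ℤ) + 1 = 2) (by omega)]
    simp
  d_act {a b i j n i' j' n'} h hi hj hn h₁ h₂ f x := by
    subst hi hj
    simp only [LinearMap.add_apply, LinearMap.comp_apply, map_add, smul_add]
    rw [M.d_act h rfl rfl hn h₁ h₂, G.map_d rfl (by omega)]
    simp only [map_add, map_sub, map_smul, LinearMap.add_apply, LinearMap.sub_apply,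
      LinearMap.smul_apply]
    rw [M.comp_act (by omega : 1 + i = i + 1) h₁ h (by omega : 1 + n = n'),
      M.comp_act rfl h₁ (by omega : 1 + j = j + 1) h₂]
    abel
  one_act h x := by
    rw [LinearMap.comp_apply, G.map_one, M.one_act]
  comp_act h₁ h₂ h₃ h₄ f g x := by
    simp only [LinearMap.comp_apply, G.map_comp]
    exact M.comp_act h₁ h₂ h₃ h₄ _ _ x

theorem restr_d (G : TwistedFunctor D C) (M : DGModule C) (a : D.Obj) {i j : ℤ} (h : i + 1 = j)
    (x : M.X (G.obj a) i) : (G.restr M).d a h x =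
      M.d (G.obj a) h x + M.act ((add_comm 1 _).trans h) (G.twist a) x := rfl

/-- The restriction functor along a twisted functor. -/
abbrev restrFunctor (G : TwistedFunctor D C) : DGModule C ⥤ DGModule D where
  obj M := G.restr M
  map f :=
    { app := fun a i => f.app (G.obj a) i
      app_d := fun h x => by
        rw [restr_d, restr_d, map_add, f.app_d, f.app_act]
      app_act := fun h y x => f.app_act h _ x }

theorem restrFunctor_map_app (G : TwistedFunctor D C) {M N : DGModule C} (f : M ⟶ N)
    (a : D.Obj) (i : ℤ) : (G.restrFunctor.map f).app a i = f.app (G.obj a) i := rfl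

/-- The restriction of a homotopy. -/
def restrHomotopy (G : TwistedFunctor D C) {M N : DGModule C} {f g : M ⟶ N}
    (H : DGModule.Homotopy f g) :
    DGModule.Homotopy (G.restrFunctor.map f) (G.restrFunctor.map g) where
  h a _ _ e := H.h (G.obj a) e
  h_act e ej en e' y x := H.h_act e ej en e' _ x
  comm {a i j l} e e' x := by
    -- A homotopy has degree `-1`, so it anticommutes with the action of the twist, and the extra
    -- terms of the twisted differentials cancel in `d h + h d`.
    have h1 := H.h_act (by omega : 1 + i = j) e' e (by omega : 1 + l = i) (G.twist a) x
    rw [restr_d, restr_d, map_add, h1, restrFunctor_map_app, restrFunctor_map_app, H.comm e e']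
    simp only [sgn_one, neg_smul, one_smul]
    abel

end TwistedFunctor

/-! ### Restriction of shifts, cones, exact triples and coacyclic modules -/

/-- An isomorphism of DG-modules from a closed morphism with an inverse family of linear maps. -/
def DGModule.isoMk {C : DGCategory k} {M N : DGModule C} (f : M ⟶ N)
    (g : ∀ (a : C.Obj) (i : ℤ), N.X a i →ₗ[k] M.X a i)
    (hfg : ∀ (a : C.Obj) (i : ℤ) (x : M.X a i), g a i (f.app a i x) = x)
    (hgf : ∀ (a : C.Obj) (i : ℤ) (y : N.X a i), f.app a i (g a i y) = y) : M ≅ N where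
  hom := f
  inv :=
    { app := g
      app_d := fun h x => by
        conv_lhs => rw [← hgf _ _ x, ← f.app_d, hfg]
      app_act := fun h y x => by
        conv_lhs => rw [← hgf _ _ x, ← f.app_act, hfg] }
  hom_inv_id := DGModule.hom_ext fun a i x => hfg a i x
  inv_hom_id := DGModule.hom_ext fun a i x => hgf a i x

namespace TwistedFunctor

variable {C D : DGCategory k} (G : TwistedFunctor D C)

/-- Restriction commutes with the shift. -/
def restrShiftIso (M : DGModule C) : G.restr M.shift ≅ (G.restr M).shift :=
  DGModule.isoMk (N := (G.restr M).shift)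
    { app := fun a i => LinearMap.id
      app_d := fun {a i j} h x => by
        -- On `M[1]` an element of degree `1` acts with the sign `-1`, the same sign that the shift
        -- puts on `d`; hence the identity map is closed.
        change -M.d _ _ x + sgn k 1 • M.act _ (G.twist a) x =
          -(M.d _ _ x + M.act _ (G.twist a) x)
        simp only [sgn_one, neg_smul, one_smul, neg_add]
      app_act := fun h y x => rfl }
    (fun a i => LinearMap.id) (fun _ _ _ => rfl) (fun _ _ _ => rfl)

/-- Restriction commutes with cones. -/
def restrConeIso {M N : DGModule C} (f : M ⟶ N) :
    G.restr (DGModule.cone f) ≅ DGModule.cone (G.restrFunctor.map f) :=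
  DGModule.isoMk (N := DGModule.cone (G.restrFunctor.map f))
    { app := fun a i => LinearMap.id
      app_d := fun {a i j} h x => by
        subst h
        refine Prod.ext ?_ ?_
        · change -M.d _ _ x.1 + sgn k 1 • M.act _ (G.twist a) x.1 =
            -(M.d _ _ x.1 + M.act _ (G.twist a) x.1)
          simp only [sgn_one, neg_smul, one_smul, neg_add]
        · exact add_assoc _ _ _
      app_act := fun h y x => rfl }
    (fun a i => LinearMap.id) (fun _ _ _ => rfl) (fun _ _ _ => rfl)

theorem restr_coneIn {M N : DGModule C} (f : M ⟶ N) :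
    G.restrFunctor.map (DGModule.coneIn f) ≫ (G.restrConeIso f).hom =
      DGModule.coneIn (G.restrFunctor.map f) := rfl

theorem restr_coneOut {M N : DGModule C} (f : M ⟶ N) :
    G.restrFunctor.map (DGModule.coneOut f) ≫ (G.restrShiftIso M).hom =
      (G.restrConeIso f).hom ≫ DGModule.coneOut (G.restrFunctor.map f) := rfl

theorem restr_exact {M N P : DGModule C} {f : M ⟶ N} {g : N ⟶ P} (h : IsExactTriple f g) :
    IsExactTriple (G.restrFunctor.map f) (G.restrFunctor.map g) where
  injective a i := h.injective (G.obj a) i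
  zero a i := h.zero (G.obj a) i
  exact a i := h.exact (G.obj a) i
  surjective a i := h.surjective (G.obj a) i

/-- Morphisms of DG-modules with isomorphic sources have isomorphic cones. -/
def _root_.HomotopyCharacters.DGModule.coneIsoOfIso {M M' N : DGModule C} (e : M ≅ M')
    (f : M ⟶ N) (f' : M' ⟶ N) (w : e.hom ≫ f' = f) : DGModule.cone f ≅ DGModule.cone f' := by
  subst w
  have h1 : ∀ a i x, e.inv.app a i (e.hom.app a i x) = x := fun a i x =>
    congrArg (fun t : M ⟶ M => t.app a i x) e.hom_inv_id
  have h2 : ∀ a i x, e.hom.app a i (e.inv.app a i x) = x := fun a i x =>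
    congrArg (fun t : M' ⟶ M' => t.app a i x) e.inv_hom_id
  exact DGModule.isoMk
    { app := fun a i => LinearMap.prodMap (e.hom.app a (i + 1)) LinearMap.id
      app_d := fun {a i j} h x => by
        subst h
        refine Prod.ext ?_ rfl
        change e.hom.app a (i + 1 + 1) (-M.d a rfl x.1) = -M'.d a rfl (e.hom.app a (i + 1) x.1)
        rw [map_neg, e.hom.app_d]
      app_act := fun {a b i j n} h y x => by
        refine Prod.ext ?_ rfl
        change e.hom.app a (n + 1) (sgn k i • M.act _ y x.1) =
          sgn k i • M'.act _ y (e.hom.app b (j + 1) x.1)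
        rw [map_smul, e.hom.app_act] }
    (fun a i => LinearMap.prodMap (e.inv.app a (i + 1)) LinearMap.id)
    (fun a i x => Prod.ext (h1 a _ _) rfl) (fun a i x => Prod.ext (h2 a _ _) rfl)

/-- The functor of homotopy categories induced by restriction. -/
def restrHo : Ho C ⥤ Ho D :=
  CategoryTheory.Quotient.lift _ (G.restrFunctor ⋙ toHo D)
    (fun _ _ _ _ ⟨H⟩ => CategoryTheory.Quotient.sound _ ⟨G.restrHomotopy H⟩)

/-- Induction on the generation of coacyclic modules, since restriction commutes with each
generating operation. Direct sums are formed in the homotopy category as arbitrary coproducts, so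
there the induced functor must preserve colimits; in the application it is an equivalence. -/
theorem coAcyclic_restr [Limits.PreservesColimitsOfSize.{u, u} G.restrHo]
    {M : DGModule C} (h : CoAcyclic M) : CoAcyclic (G.restr M) := by
  induction h with
  | tot f g h =>
    refine .iso ((toHo D).mapIso ?_) (.tot _ _ (G.restr_exact h))
    -- A totalization is an iterated cone: one isomorphism replaces the inner cone, which is the
    -- source of the outer map, and the other moves restriction past the outer cone.
    refine (DGModule.coneIsoOfIso (G.restrConeIso f).symm _ _ ?_) ≪≫ (G.restrConeIso _).symm
    rfl
  | iso e _ ih => exact .iso (G.restrHo.mapIso e) ih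
  | shift _ ih => exact .iso ((toHo D).mapIso (G.restrShiftIso _).symm) (.shift ih)
  | unshift _ ih => exact .unshift (.iso ((toHo D).mapIso (G.restrShiftIso _)) ih)
  | cone f _ _ ih₁ ih₂ =>
    exact .iso ((toHo D).mapIso (G.restrConeIso f).symm) (.cone _ ih₁ ih₂)
  | @sum ι M c hc _ ih =>
    exact .sum (fun i => G.restr (M i))
      (Limits.Cofan.mk (G.restrHo.obj c.pt) fun i => G.restrHo.map (c.inj i))
      (Limits.isColimitCofanMkObjOfIsColimit G.restrHo _ _
        (hc.ofIsoColimit (Limits.Cofan.ext (Iso.refl _) (by simp)))) ih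

theorem coWeq_restrHo [Limits.PreservesColimitsOfSize.{u, u} G.restrHo]
    {X Y : Ho C} (φ : X ⟶ Y) (h : coWeq C φ) : coWeq D (G.restrHo.map φ) := by
  obtain ⟨f, rfl, hf⟩ := h
  exact ⟨G.restrFunctor.map f, rfl,
    .iso ((toHo D).mapIso (G.restrConeIso f)) (G.coAcyclic_restr hf)⟩

end TwistedFunctor

/-! ### Invertible, not necessarily closed, natural transformations -/

/-- An isomorphism from the identity of `D` to the composition of twisted functors
`D → C → D`. Its components `u` need not be closed. -/
structure TwistedUnit {C D : DGCategory k} (G : TwistedFunctor D C) (G' : TwistedFunctor C D) where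
  u : ∀ b : D.Obj, D.Hom b (G'.obj (G.obj b)) 0
  v : ∀ b : D.Obj, D.Hom (G'.obj (G.obj b)) b 0
  u_v : ∀ (b : D.Obj) (h : (0 : ℤ) + 0 = 0), D.comp h (u b) (v b) = D.one b
  v_u : ∀ (b : D.Obj) (h : (0 : ℤ) + 0 = 0), D.comp h (v b) (u b) = D.one _
  u_nat : ∀ {b c : D.Obj} {i : ℤ} (h : i + 0 = i) (h' : 0 + i = i) (f : D.Hom b c i),
    D.comp h f (u c) = D.comp h' (u b) (G'.map (G.map f))
  u_d : ∀ (b : D.Obj) (h : (0 : ℤ) + 1 = 1),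
    D.d h (u b) = D.comp h (u b) (G'.twist (G.obj b) + G'.map (G.twist b))

namespace TwistedUnit

variable {C D : DGCategory k} {G : TwistedFunctor D C} {G' : TwistedFunctor C D}
  (η : TwistedUnit G G')

theorem v_nat {b c : D.Obj} {i : ℤ} (h : i + 0 = i) (h' : 0 + i = i) (f : D.Hom b c i) :
    D.comp h' (η.v b) f = D.comp h (G'.map (G.map f)) (η.v c) := by
  have h1 := congrArg (fun w => D.comp h' (η.v b) (D.comp h w (η.v c))) (η.u_nat h h' f)
  rw [D.assoc h h (add_zero 0) h, η.u_v, D.comp_one, D.assoc h' h h h',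
    ← D.assoc (add_zero 0) h' h' h', η.v_u, D.one_comp] at h1
  exact h1

/-- Forced by `v u = 1`: differentiate this identity, using `d 1 = 0`, then multiply by `v` on the
right. It is what makes `v` the unit of the opposite functors. -/
theorem v_d (b : D.Obj) (h : (0 : ℤ) + 1 = 1) (h' : (1 : ℤ) + 0 = 1) :
    D.d h (η.v b) = -D.comp h' (G'.twist (G.obj b) + G'.map (G.twist b)) (η.v b) := by
  have h1 := D.d_comp (add_zero 0) h h h h' h (η.v b) (η.u b)
  rw [η.v_u, D.d_one, η.u_d, sgn_zero, one_smul, ← D.assoc (add_zero 0) h h h, η.v_u, D.one_comp]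
    at h1
  have h2 := congrArg (fun w => D.comp h' w (η.v b)) (eq_neg_of_add_eq_zero_left h1.symm)
  simp only [map_neg, LinearMap.neg_apply] at h2
  rw [D.assoc h' h' (add_zero 0) h', η.u_v, D.comp_one] at h2
  exact h2

/-- The opposite of a unit isomorphism. -/
def op : TwistedUnit G.op G'.op where
  -- Passing to the opposite category reverses arrows, so the inverse component takes the role of
  -- `u`.
  u := η.v
  v := η.u
  u_v := fun (b : D.Obj) h => by
    change sgn k (0 * 0) • D.comp h (η.u b) (η.v b) = D.one b
    rw [η.u_v, mul_zero, sgn_zero, one_smul]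
  v_u := fun (b : D.Obj) h => by
    change sgn k (0 * 0) • D.comp h (η.v b) (η.u b) = D.one _
    rw [η.v_u, mul_zero, sgn_zero, one_smul]
  u_nat := fun {b c : D.Obj} {i} h h' (f : D.Hom c b i) => by
    change sgn k (i * 0) • D.comp h' (η.v c) f =
      sgn k (0 * i) • D.comp h (G'.map (G.map f)) (η.v b)
    rw [mul_zero, zero_mul]
    exact congrArg _ (η.v_nat (b := c) (c := b) h h' f)
  u_d := fun (b : D.Obj) h => by
    change D.d h (η.v b) = sgn k (0 * 1) • D.comp (add_zero 1)
      (-G'.twist (G.obj b) + G'.map (-G.twist b)) (η.v b)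
    rw [η.v_d b h (add_zero 1)]
    simp only [map_neg, ← neg_add, LinearMap.neg_apply, zero_mul, sgn_zero, one_smul]

/-- The isomorphism between the iterated restriction of a DG-module and the module. -/
def restrIso (N : DGModule D) : G.restr (G'.restr N) ≅ N :=
  DGModule.isoMk
    { app := fun b i => N.act (zero_add i) (η.u b)
      app_d := fun {b i j} h x => by
        subst h
        -- The source differential carries both twists. By `u_d` they are exactly what `d u`
        -- contributes to `d (u x) = (d u) x + u (d x)`, so acting by the non-closed `u` is a closed
        -- morphism.
        change N.act _ (η.u b) ((N.d _ rfl x + N.act _ (G'.twist (G.obj b)) x) +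
          N.act _ (G'.map (G.twist b)) x) = N.d b rfl (N.act _ (η.u b) x)
        rw [N.d_act (zero_add i) (zero_add 1) rfl rfl (add_comm 1 i) (zero_add _), η.u_d,
          N.comp_act (zero_add 1) (add_comm 1 i) (add_comm 1 i) (zero_add _)]
        simp only [map_add, LinearMap.add_apply, sgn_zero, one_smul]
        abel
      app_act := fun {a b i j n} h f x => by
        change N.act _ (η.u a) (N.act h (G'.map (G.map f)) x) = N.act h f (N.act _ (η.u b) x)
        rw [← N.comp_act (zero_add i) h h (zero_add n),
          ← N.comp_act (add_zero i) h (zero_add j) h, η.u_nat] }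
    (fun b i => N.act (zero_add i) (η.v b))
    (fun b i x => by
      change N.act _ (η.v b) (N.act _ (η.u b) x) = x
      rw [← N.comp_act (add_zero 0) (zero_add i) (zero_add i) (zero_add i), η.v_u, N.one_act])
    (fun b i x => by
      change N.act _ (η.u b) (N.act _ (η.v b) x) = x
      rw [← N.comp_act (add_zero 0) (zero_add i) (zero_add i) (zero_add i), η.u_v, N.one_act])

/-- The natural isomorphism between the iterated restriction functor and the identity. -/
def restrNatIso : G'.restrFunctor ⋙ G.restrFunctor ≅ 𝟭 (DGModule D) :=
  NatIso.ofComponents η.restrIso fun f =>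
    DGModule.hom_ext fun a i x => (f.app_act (zero_add i) (η.u a) x).symm

/-- The natural isomorphism on homotopy categories. -/
def restrHoIso : G'.restrHo ⋙ G.restrHo ≅ 𝟭 (Ho D) :=
  CategoryTheory.Quotient.natIsoLift _
    (Functor.isoWhiskerRight η.restrNatIso (toHo D))

end TwistedUnit

/-! ### From twisted equivalences to equivalences of coderived categories -/

/-- Mutually inverse twisted functors. -/
structure TwistedEquivalence (C D : DGCategory k) where
  functor : TwistedFunctor C D
  inverse : TwistedFunctor D C
  unit : TwistedUnit functor inverse
  counit : TwistedUnit inverse functor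

namespace TwistedEquivalence

variable {C D : DGCategory k} (E : TwistedEquivalence C D)

/-- The opposite equivalence. -/
def op : TwistedEquivalence C.op D.op where
  functor := E.functor.op
  inverse := E.inverse.op
  unit := E.unit.op
  counit := E.counit.op

/-- The equivalence of homotopy categories. -/
def hoEquivalence : Ho C ≌ Ho D :=
  CategoryTheory.Equivalence.mk E.inverse.restrHo E.functor.restrHo
    E.unit.restrHoIso.symm E.counit.restrHoIso

instance : E.inverse.restrHo.IsEquivalence :=
  inferInstanceAs E.hoEquivalence.functor.IsEquivalence

instance : E.functor.restrHo.IsEquivalence :=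
  inferInstanceAs E.hoEquivalence.inverse.IsEquivalence

/-- Restriction along the inverse, as a morphism of localizers. -/
def localizerMorphism : LocalizerMorphism (coWeq C) (coWeq D) where
  functor := E.inverse.restrHo
  map _ _ φ h := E.inverse.coWeq_restrHo φ h

/-- Restriction along the functor, as a morphism of localizers. -/
def localizerMorphismInverse : LocalizerMorphism (coWeq D) (coWeq C) where
  functor := E.functor.restrHo
  map _ _ φ h := E.functor.coWeq_restrHo φ h

/-- The functor of coderived categories. -/
def dcoFunctor : Dco C ⥤ Dco D :=
  E.localizerMorphism.localizedFunctor (coWeq C).Q (coWeq D).Q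

/-- The inverse functor of coderived categories. -/
def dcoInverse : Dco D ⥤ Dco C :=
  E.localizerMorphismInverse.localizedFunctor (coWeq D).Q (coWeq C).Q

instance : Localization.Lifting (coWeq C).Q (coWeq C) (E.inverse.restrHo ⋙ (coWeq D).Q)
    E.dcoFunctor :=
  inferInstanceAs (Localization.Lifting (coWeq C).Q (coWeq C)
    (E.localizerMorphism.functor ⋙ (coWeq D).Q)
    (E.localizerMorphism.localizedFunctor (coWeq C).Q (coWeq D).Q))

instance : Localization.Lifting (coWeq D).Q (coWeq D) (E.functor.restrHo ⋙ (coWeq C).Q)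
    E.dcoInverse :=
  inferInstanceAs (Localization.Lifting (coWeq D).Q (coWeq D)
    (E.localizerMorphismInverse.functor ⋙ (coWeq C).Q)
    (E.localizerMorphismInverse.localizedFunctor (coWeq D).Q (coWeq C).Q))

/-- The compatibility of the functor of coderived categories with restriction. -/
def dcoIso : (coWeq C).Q ⋙ E.dcoFunctor ≅ E.inverse.restrHo ⋙ (coWeq D).Q :=
  Localization.Lifting.iso (coWeq C).Q (coWeq C) _ _

/-- The compatibility of the inverse functor of coderived categories with restriction. -/
def dcoInverseIso : (coWeq D).Q ⋙ E.dcoInverse ≅ E.functor.restrHo ⋙ (coWeq C).Q :=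
  Localization.Lifting.iso (coWeq D).Q (coWeq D) _ _

/-- The equivalence of coderived categories. -/
def dcoEquivalence : Dco C ≌ Dco D :=
  Localization.equivalence (coWeq C).Q (coWeq C) (coWeq D).Q (coWeq D)
    (E.inverse.restrHo ⋙ (coWeq D).Q) E.dcoFunctor
    (E.functor.restrHo ⋙ (coWeq C).Q) E.dcoInverse
    (Functor.isoWhiskerLeft E.inverse.restrHo E.dcoInverseIso ≪≫
      (Functor.associator _ _ _).symm ≪≫
      Functor.isoWhiskerRight E.unit.restrHoIso (coWeq C).Q ≪≫ Functor.leftUnitor _)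
    (Functor.isoWhiskerLeft E.functor.restrHo E.dcoIso ≪≫
      (Functor.associator _ _ _).symm ≪≫
      Functor.isoWhiskerRight E.counit.restrHoIso (coWeq D).Q ≪≫ Functor.leftUnitor _)

end TwistedEquivalence

/-! ### Compatibility with shifts and distinguished triangles -/

/-- The shift of the coderived category is induced by the shift of the homotopy category. -/
def shiftDcoIso (C : DGCategory k) :
    (coWeq C).Q ⋙ shiftDco C ≅ shiftHo C ⋙ (coWeq C).Q :=
  -- The shift on the localization is a strict lift, so the comparison has identity components;
  -- naturality is the equality of functors evaluated on morphisms.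
  NatIso.ofComponents (fun X => Iso.refl _) fun f => by
    have := Functor.congr_hom (Localization.Construction.fac _ (coWeq_shift C)) f
    refine (Category.comp_id _).trans (Eq.trans ?_ (Category.id_comp _).symm)
    refine this.trans ?_
    exact (Category.id_comp _).trans (Category.comp_id _)

/-- Restriction commutes with the shifts of the homotopy categories. -/
def TwistedFunctor.restrShiftHoIso {C D : DGCategory k} (G : TwistedFunctor D C) :
    shiftHo C ⋙ G.restrHo ≅ G.restrHo ⋙ shiftHo D :=
  CategoryTheory.Quotient.natIsoLift _
    (NatIso.ofComponents (fun M => (toHo D).mapIso (G.restrShiftIso M)) fun _ => rfl)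

/-- The five factors in `h` mirror those of `dcoShiftIso`: the two identities come from the strict
lifts of the shifts, and the final `S.map m.inv` is what gets cancelled. -/
theorem comp_map_hom_of_eq {A B : Type*} [Category* A] [Category* B] (F : A ⥤ B) (S : B ⥤ B)
    {X : A} {Y Y' Y'' : B} (a : F.obj X ⟶ Y) (b : Y ⟶ S.obj Y') (m : Y'' ≅ Y')
    {x : F.obj X ⟶ S.obj Y''} (h : x = F.map (𝟙 X) ≫ a ≫ b ≫ 𝟙 _ ≫ S.map m.inv) :
    x ≫ S.map m.hom = a ≫ b := by
  simp [h, ← Functor.map_comp]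

/-- The diagram chase for the connecting morphism of a triangle: naturality of `t` moves `α` past
the shift, `h` trades it for `γ` and `o`, and the remaining squares express compatibility of
restriction with the projection of the cone. -/
theorem map_triangle_third {A B : Type*} [Category* A] [Category* B] (F : A ⥤ B) {S : A ⥤ A}
    {S' : B ⥤ B} (t : S ⋙ F ≅ F ⋙ S') {X Z M K : A} {M' K₁ K₂ L : B} (r : Z ⟶ S.obj X)
    (α : X ⟶ M) (γ : Z ⟶ K) (o : K ⟶ S.obj M) (h : r ≫ S.map α = γ ≫ o) (m : F.obj M ⟶ M')
    (c : F.obj K ⟶ K₁) (e : K₁ ⟶ K₂) (o' : K₂ ⟶ S'.obj M') (n : F.obj (S.obj M) ⟶ L)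
    (s : L ⟶ S'.obj M') (ht : t.hom.app M ≫ S'.map m = n ≫ s) (o₁ : K₁ ⟶ L)
    (hc : F.map o ≫ n = c ≫ o₁) (ho : o₁ ≫ s = e ≫ o') :
    (F.map r ≫ t.hom.app X) ≫ S'.map (F.map α ≫ m) = (F.map γ ≫ c ≫ e) ≫ o' := by
  have h1 := t.hom.naturality α
  simp only [Functor.comp_map] at h1
  rw [Functor.map_comp, Category.assoc, ← reassoc_of% h1, ht, ← Functor.map_comp_assoc, h,
    Functor.map_comp_assoc, reassoc_of% hc, ho, Category.assoc, Category.assoc]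

namespace TwistedEquivalence

variable {C D : DGCategory k} (E : TwistedEquivalence C D)

/-- The functor of coderived categories commutes with the shifts, on objects that come from
the homotopy category. -/
def dcoShiftIso : (coWeq C).Q ⋙ shiftDco C ⋙ E.dcoFunctor ≅
    (coWeq C).Q ⋙ E.dcoFunctor ⋙ shiftDco D :=
  Functor.isoWhiskerRight (shiftDcoIso C) E.dcoFunctor ≪≫
  Functor.isoWhiskerLeft (shiftHo C) E.dcoIso ≪≫
  Functor.isoWhiskerRight E.inverse.restrShiftHoIso (coWeq D).Q ≪≫
  Functor.isoWhiskerLeft E.inverse.restrHo (shiftDcoIso D).symm ≪≫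
  Functor.isoWhiskerRight E.dcoIso.symm (shiftDco D)

/-- The functor of coderived categories commutes with the shifts. -/
def dcoCommShift : shiftDco C ⋙ E.dcoFunctor ≅ E.dcoFunctor ⋙ shiftDco D :=
  Localization.liftNatIso (coWeq C).Q (coWeq C) _ _ _ _ E.dcoShiftIso

/-- The functor of coderived categories on modules. -/
def dcoObjIso (M : DGModule C) :
    E.dcoFunctor.obj ((toDco C).obj M) ≅ (toDco D).obj (E.inverse.restr M) :=
  E.dcoIso.app ((toHo C).obj M)

theorem dcoObjIso_naturality {M N : DGModule C} (f : M ⟶ N) :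
    E.dcoFunctor.map ((toDco C).map f) ≫ (E.dcoObjIso N).hom =
      (E.dcoObjIso M).hom ≫ (toDco D).map (E.inverse.restrFunctor.map f) :=
  E.dcoIso.hom.naturality ((toHo C).map f)

/-- On objects coming from modules, the abstractly lifted shift isomorphism is the concrete one
given by restriction; this lets the third square of a triangle be checked on modules. -/
theorem dcoCommShift_obj (M : DGModule C) :
    E.dcoCommShift.hom.app ((toDco C).obj M) ≫ (shiftDco D).map (E.dcoObjIso M).hom =
      (E.dcoObjIso M.shift).hom ≫ (toDco D).map (E.inverse.restrShiftIso M).hom := by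
  have h1 : E.dcoCommShift.hom.app ((toDco C).obj M) =
      E.dcoShiftIso.hom.app ((toHo C).obj M) := by
    refine (Localization.liftNatTrans_app (coWeq C).Q (coWeq C) _ _ _ _ _ _).trans ?_
    exact (Category.id_comp _).trans (Category.comp_id _)
  rw [h1]
  exact comp_map_hom_of_eq E.dcoFunctor (shiftDco D) (E.dcoObjIso M.shift).hom _
    (E.dcoObjIso M) rfl

/-- Mutually inverse twisted functors induce an equivalence of coderived categories. -/
def coderivedEquivalence : CoderivedEquivalence C D where
  equiv := E.dcoEquivalence
  commShift := E.dcoCommShift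
  distinguished {X Y Z} p q r := by
    rintro ⟨M, N, f, α, β, γ, h1, h2, h3⟩
    refine ⟨E.inverse.restr M, E.inverse.restr N, E.inverse.restrFunctor.map f,
      E.dcoFunctor.mapIso α ≪≫ E.dcoObjIso M, E.dcoFunctor.mapIso β ≪≫ E.dcoObjIso N,
      E.dcoFunctor.mapIso γ ≪≫ E.dcoObjIso _ ≪≫ (toDco D).mapIso (E.inverse.restrConeIso f),
      ?_, ?_, ?_⟩
    · change E.dcoFunctor.map p ≫ E.dcoFunctor.map β.hom ≫ (E.dcoObjIso N).hom =
        (E.dcoFunctor.map α.hom ≫ (E.dcoObjIso M).hom) ≫ _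
      rw [← Functor.map_comp_assoc, h1, Functor.map_comp_assoc, dcoObjIso_naturality,
        Category.assoc]
    · change E.dcoFunctor.map q ≫ E.dcoFunctor.map γ.hom ≫ (E.dcoObjIso _).hom ≫
        (toDco D).map (E.inverse.restrConeIso f).hom =
        (E.dcoFunctor.map β.hom ≫ (E.dcoObjIso N).hom) ≫ _
      rw [← Functor.map_comp_assoc, h2, Functor.map_comp_assoc,
        Category.assoc]
      refine congrArg _ ((Category.assoc _ _ _).symm.trans ?_)
      rw [E.dcoObjIso_naturality (DGModule.coneIn f), Category.assoc, ← Functor.map_comp,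
        TwistedFunctor.restr_coneIn]
    · have h4 := congrArg (toDco D).map (E.inverse.restr_coneOut f)
      rw [Functor.map_comp, Functor.map_comp] at h4
      exact map_triangle_third E.dcoFunctor E.dcoCommShift r α.hom γ.hom _ h3
        (E.dcoObjIso M).hom _ _ _ _ _ (E.dcoCommShift_obj M) _
        (E.dcoObjIso_naturality (DGModule.coneOut f)) h4

end TwistedEquivalence

/-! ### The reduced Cobar differential as a twist by `s1` -/

namespace DGBialgebra

variable (A : DGBialgebra k)

/-- The pieces depend only on the grading of `A`, and the two coalgebras differ only in the
comultiplication. -/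
theorem barCoalgebra_piece (n : ℕ) (m : ℤ) :
    A.barCoalgebra.piece n m = A.toDGCoalgebra.piece n m := by
  induction n generalizing m with
  | zero => rfl
  | succ n ih =>
    unfold DGCoalgebra.piece
    exact iSup_congr fun e => congrArg (_ * ·) (ih _)

theorem barCoalgebra_cobarPiece (m : ℤ) :
    A.barCoalgebra.cobarPiece m = A.toDGCoalgebra.cobarPiece m :=
  SetLike.ext fun _ => forall_congr' fun n => by rw [barCoalgebra_piece]

/-- The generator `s1` of degree `1`, as an element of the completed tensor algebra. -/
def unitElt : PowerSeries A.toDGCoalgebra.T :=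
  PowerSeries.monomial 1 (A.toDGCoalgebra.gen (1 : A.X))

theorem unitElt_mem : A.unitElt ∈ A.toDGCoalgebra.cobarPiece 1 := fun n => by
  rw [unitElt, PowerSeries.coeff_monomial]
  split_ifs with h
  · subst h
    exact A.toDGCoalgebra.gen_mem_piece (zero_add 1)
      (SetLike.GradedOne.one_mem (A := A.gr) : (1 : A.X) ∈ A.gr 0)
  · exact Submodule.zero_mem _

/-- Exhibits the central variable `X`, which also multiplies the quadratic part of the Cobar
differential, so that the two can be compared under a common factor. -/
theorem unitElt_eq : A.unitElt =
    PowerSeries.X * PowerSeries.C (A.toDGCoalgebra.gen (1 : A.X)) := by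
  ext n
  rw [unitElt, PowerSeries.coeff_monomial]
  cases n with
  | zero => simp
  | succ n => rw [PowerSeries.coeff_succ_X_mul, PowerSeries.coeff_C]; simp

/-- Since `d 1 = 0` and `Δ 1 = 1 ⊗ 1`, only the quadratic term survives, and the sign `(-1)^(|1| +
1) = -1` turns it into `-(s1)²`. -/
theorem cobarD_unitElt : A.toDGCoalgebra.cobarD A.unitElt + A.unitElt * A.unitElt = 0 := by
  have h1 : A.toDGCoalgebra.dLin (A.toDGCoalgebra.gen (1 : A.X)) = 0 := by
    refine (A.toDGCoalgebra.der_gen _ _).trans ?_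
    change -A.toDGCoalgebra.gen (A.d 1) = 0
    rw [A.d_one, map_zero, neg_zero]
  have h2 : A.toDGCoalgebra.dQuad (A.toDGCoalgebra.gen (1 : A.X)) =
      -(A.toDGCoalgebra.gen (1 : A.X) * A.toDGCoalgebra.gen (1 : A.X)) := by
    refine (A.toDGCoalgebra.der_gen _ _).trans ?_
    change A.toDGCoalgebra.quad (Coalgebra.comul (R := k) (1 : A.X)) = _
    rw [A.comul_one]
    refine (A.toDGCoalgebra.quad_tmul (1 : A.X) (1 : A.X)).trans ?_
    exact congrArg (fun w => -(A.toDGCoalgebra.gen w * _)) A.signOp_one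
  ext n
  rw [DGCoalgebra.cobarD_apply, map_add, map_add, DGCoalgebra.coeff_mapCoeff, unitElt,
    PowerSeries.monomial_mul_monomial, PowerSeries.coeff_monomial, PowerSeries.coeff_monomial]
  cases n with
  | zero => simp
  | succ n =>
    rw [PowerSeries.coeff_succ_X_mul, DGCoalgebra.coeff_mapCoeff, PowerSeries.coeff_monomial]
    by_cases hn : n = 0
    · subst hn; simp [h1]
    -- The index is `n + 1`, so this is tensor length `2`, the only one where the terms are nonzero
    -- and must cancel.
    · by_cases hn' : n = 1
      · subst hn'; simp [h2]
      · simp [hn, hn']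

/-- The graded commutator with `s1` obeys the same `sigma`-twisted Leibniz rule as the quadratic
differentials, so agreement on generators propagates to the whole tensor algebra. -/
theorem barCoalgebra_dQuad_apply (x : TensorAlgebra k A.X) :
    (A.barCoalgebra.dQuad x : TensorAlgebra k A.X) = A.toDGCoalgebra.dQuad x +
      TensorAlgebra.ι k (1 : A.X) * x -
      A.toDGCoalgebra.sigma x * TensorAlgebra.ι k (1 : A.X) := by
  induction x using TensorAlgebra.induction with
  | algebraMap r =>
    have h1 := A.barCoalgebra.der_algebraMap
      (A.barCoalgebra.quad.comp A.barCoalgebra.comul) r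
    have h2 := A.toDGCoalgebra.der_algebraMap
      (A.toDGCoalgebra.quad.comp A.toDGCoalgebra.comul) r
    refine h1.trans ?_
    refine Eq.trans ?_ (congrArg (fun w : TensorAlgebra k A.X => w + _ - _) h2.symm)
    rw [zero_add, AlgHom.commutes, Algebra.commutes, sub_self]
  | ι x =>
    rw [barCoalgebra_dQuad]
    have := A.toDGCoalgebra.sigma_gen x
    refine Eq.trans ?_ (congrArg (fun w : TensorAlgebra k A.X => _ - w * _) this.symm)
    rw [neg_mul, sub_neg_eq_add]
  | mul x y hx hy =>
    have h1 := A.barCoalgebra.der_mul (A.barCoalgebra.quad.comp A.barCoalgebra.comul) x y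
    have h2 := A.toDGCoalgebra.der_mul (A.toDGCoalgebra.quad.comp A.toDGCoalgebra.comul) x y
    refine h1.trans ?_
    refine (congrArg₂ (fun v w : TensorAlgebra k A.X =>
      v * y + A.toDGCoalgebra.sigma x * w) hx hy).trans ?_
    refine Eq.trans ?_ (congrArg (fun w : TensorAlgebra k A.X => w + _ - _) h2.symm)
    rw [map_mul]
    change _ = A.toDGCoalgebra.dQuad x * y + A.toDGCoalgebra.sigma x * A.toDGCoalgebra.dQuad y +
      _ - _
    noncomm_ring
  | add x y hx hy =>
    refine (map_add A.barCoalgebra.dQuad x y).trans ?_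
    refine (congrArg₂ (fun v w : TensorAlgebra k A.X => v + w) hx hy).trans ?_
    rw [map_add, map_add]
    noncomm_ring

/-- The linear parts agree and the quadratic parts differ by the commutator with `s1`; on degree `i`
the automorphism `sigma` is the sign `(-1)^i`. The right side is the differential of `End(s1)` in
the homotopy limit. -/
theorem barCoalgebra_cobarD {i : ℤ} {x : PowerSeries A.toDGCoalgebra.T}
    (hx : x ∈ A.toDGCoalgebra.cobarPiece i) :
    (A.barCoalgebra.cobarD x : PowerSeries A.toDGCoalgebra.T) =
      A.toDGCoalgebra.cobarD x + A.unitElt * x - sgn k i • (x * A.unitElt) := by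
  have h1 : (A.barCoalgebra.cobarD x : PowerSeries A.toDGCoalgebra.T) =
      A.toDGCoalgebra.mapCoeff A.toDGCoalgebra.dLin x +
        PowerSeries.X * A.toDGCoalgebra.mapCoeff A.barCoalgebra.dQuad x := rfl
  have h2 : A.toDGCoalgebra.mapCoeff A.barCoalgebra.dQuad x =
      A.toDGCoalgebra.mapCoeff A.toDGCoalgebra.dQuad x +
        PowerSeries.C (A.toDGCoalgebra.gen (1 : A.X)) * x -
        sgn k i • (x * PowerSeries.C (A.toDGCoalgebra.gen (1 : A.X))) := by
    ext n
    have h3 : ∀ z : PowerSeries A.toDGCoalgebra.T, PowerSeries.coeff n (sgn k i • z) =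
      sgn k i • PowerSeries.coeff n z := fun z => by simp
    rw [map_sub, map_add, h3, PowerSeries.coeff_C_mul, PowerSeries.coeff_mul_C,
      DGCoalgebra.coeff_mapCoeff, DGCoalgebra.coeff_mapCoeff]
    refine (A.barCoalgebra_dQuad_apply _).trans ?_
    rw [A.toDGCoalgebra.sigma_piece (hx n), smul_mul_assoc]
  rw [h1, h2, DGCoalgebra.cobarD_apply, unitElt_eq, ← mul_assoc x, ← PowerSeries.X_mul]
  simp only [mul_add, mul_sub, mul_smul_comm, mul_assoc]
  abel

/-! ### The twisted equivalence with the homotopy limit -/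

/-- The object `s1` of the homotopy limit. -/
def unitObj : A.holim.Obj :=
  ⟨⟨⟨A.unitElt, A.unitElt_mem⟩, Subtype.ext A.cobarD_unitElt⟩, 1,
    ⟨SetLike.GradedOne.one_mem (A := A.gr), A.d_one, 1, SetLike.GradedOne.one_mem (A := A.gr),
      A.d_one, ⟨0, Submodule.zero_mem _, by simp⟩, ⟨0, Submodule.zero_mem _, by simp⟩⟩,
    by simp [unitElt]⟩

/-- The reduced Cobar construction as the endomorphisms of `s1` in the homotopy limit. -/
def fromCobarCoaug : TwistedFunctor A.cobarCoaug.toDGCategory A.holim where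
  obj _ := A.unitObj
  map {_ _ i} := Submodule.inclusion (A.barCoalgebra_cobarPiece i).le
  twist _ := 0
  map_one _ := rfl
  map_comp _ _ _ := rfl
  map_d {_ _ i j} h h' f := by
    simp only [map_zero, LinearMap.zero_apply, smul_zero, add_zero, sub_zero]
    exact Subtype.ext (A.barCoalgebra_cobarD ((A.barCoalgebra_cobarPiece i).le f.2))
  maurerCartan _ h := by simp

/-- The homotopy limit maps to the reduced Cobar construction, with the twist `a - s1`. -/
def toCobarCoaug : TwistedFunctor A.holim A.cobarCoaug.toDGCategory where
  obj _ := PUnit.unit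
  map {_ _ i} := Submodule.inclusion (A.barCoalgebra_cobarPiece i).ge
  twist a := ⟨a.1.1.1 - A.unitElt,
    (A.barCoalgebra_cobarPiece 1).ge (Submodule.sub_mem _ a.1.1.2 A.unitElt_mem)⟩
  map_one _ := rfl
  map_comp _ _ _ := rfl
  map_d {a b i j} h h' f := by
    refine Subtype.ext ?_
    -- Replacing `d` by the reduced differential adds `s1 f - (-1)^|f| f s1`, which the two
    -- subtracted copies of `s1` remove.
    change A.toDGCoalgebra.cobarD f.1 + a.1.1.1 * f.1 - sgn k i • (f.1 * b.1.1.1) =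
      A.barCoalgebra.cobarD f.1 + (a.1.1.1 - A.unitElt) * f.1 -
        sgn k i • (f.1 * (b.1.1.1 - A.unitElt))
    rw [A.barCoalgebra_cobarD f.2]
    simp only [sub_mul, mul_sub, smul_sub]
    abel
  maurerCartan a h := by
    refine Subtype.ext ?_
    have h1 : A.toDGCoalgebra.cobarD a.1.1.1 + a.1.1.1 * a.1.1.1 = 0 :=
      congrArg Subtype.val a.1.2
    have h2 := A.cobarD_unitElt
    change A.barCoalgebra.cobarD (a.1.1.1 - A.unitElt) +
      (a.1.1.1 - A.unitElt) * (a.1.1.1 - A.unitElt) = 0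
    -- For `x = a - s1` the reduced equation reads `d x + s1 x + x s1 + x² = (d a + a²) - (d(s1) +
    -- (s1)²)`, and both brackets vanish.
    rw [A.barCoalgebra_cobarD (Submodule.sub_mem _ a.1.1.2 A.unitElt_mem), map_sub,
      eq_neg_of_add_eq_zero_left h1, eq_neg_of_add_eq_zero_left h2]
    simp only [sub_mul, mul_sub, sgn_one, neg_smul, one_smul]
    abel

/-- The homotopy limit and the reduced Cobar construction are equivalent by twisted functors. -/
def holimEquivalence : TwistedEquivalence A.holim A.cobarCoaug.toDGCategory where
  functor := A.toCobarCoaug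
  inverse := A.fromCobarCoaug
  unit :=
    { u := fun _ => A.toDGCoalgebra.cobar.one
      v := fun _ => A.toDGCoalgebra.cobar.one
      u_v := fun _ h => A.toDGCoalgebra.cobar.one_mul h _
      v_u := fun _ h => A.toDGCoalgebra.cobar.one_mul h _
      u_nat := fun h h' f => (A.toDGCoalgebra.cobar.mul_one h f).trans
        (A.toDGCoalgebra.cobar.one_mul h' f).symm
      u_d := fun b h => by
        refine Subtype.ext ?_
        have h1 : A.toDGCoalgebra.cobarD 1 = 0 := by
          simpa using A.toDGCoalgebra.cobarD_mul A.toDGCoalgebra.one_mem_cobarPiece 1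
        -- The unit as a morphism `a → s1` has differential `a - s1`, which is precisely the twist
        -- of `toCobarCoaug`; the other twist is `0`.
        change A.toDGCoalgebra.cobarD 1 + b.1.1.1 * 1 - sgn k 0 • (1 * A.unitElt) =
          1 * (0 + (b.1.1.1 - A.unitElt))
        rw [h1]
        simp }
  counit :=
    { u := fun _ => A.cobarCoaug.one
      v := fun _ => A.cobarCoaug.one
      u_v := fun _ h => A.cobarCoaug.one_mul h _
      v_u := fun _ h => A.cobarCoaug.one_mul h _
      u_nat := fun h h' f => (A.cobarCoaug.mul_one h f).trans (A.cobarCoaug.one_mul h' f).symm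
      u_d := fun b h => by
        refine Subtype.ext ?_
        have h1 : A.barCoalgebra.cobarD 1 = 0 := by
          simpa using A.barCoalgebra.cobarD_mul A.barCoalgebra.one_mem_cobarPiece 1
        -- At the object `s1` the twist is `s1 - s1 = 0`, so here the unit is closed.
        change A.barCoalgebra.cobarD 1 = 1 * ((A.unitElt - A.unitElt) + 0)
        rw [h1]
        simp }

end DGBialgebra

end HomotopyCharacters

end

theorem mainTheorem7 {k : Type u} [Field k] (A : HomotopyCharacters.DGBialgebra k) :
    Nonempty (HomotopyCharacters.CoderivedEquivalence A.holim A.cobarCoaug.toDGCategory) ∧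
      Nonempty (HomotopyCharacters.CoderivedEquivalence A.holim.op
        A.cobarCoaug.toDGCategory.op) :=
  ⟨⟨A.holimEquivalence.coderivedEquivalence⟩, ⟨A.holimEquivalence.op.coderivedEquivalence⟩⟩
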